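/- Let $n\ge 3$ and let $P\subset\mathbb{R}^n$ be a smooth $n$-dimensional lattice polytope, that is, the convex hull of finitely many points of $\mathbb{Z}^n$, of full dimension, such that at each vertex exactly $n$ edges meet and the primitive integer vectors along these edges form a basis of $\mathbb{Z}^n$. For a simple $n$-polytope $Q$ let $f_k$ be the number of its faces of dimension $n-k-1$ ($0\le k\le n-1$) and $f_{-1}=1$; define the $h$-vector by $\sum_{k=0}^n h_kt^{n-k}=\sum_{k=0}^n f_{k-1}(t-1)^{n-k}$ and the $g$-vector $(g_0,\dots,g_{\lfloor n/2\rfloor})$ by $g_0=1$ and $g_k=h_k-h_{k-1}$ for $1\le k\le\lfloor n/2\rfloor$. Let $(1,g_1,\dots,g_{\lfloor n/2\rfloor})$ be the $g$-vector of $P$. The normal fan $\Sigma_Q$ of an $n$-polytope $Q$ is the set of the cones of inward normal vectors of $Q$ along its nonempty faces. The star subdivision of $\Sigma_P$ at a maximal cone $\tau$ in the direction of a vector $x$ in the interior of $\tau$ is obtained from $\Sigma_P$ by replacing $\tau$ with the cones $\mathrm{pos}(x,\varphi)$, where $\varphi$ runs over the cones of $\Sigma_P$ properly contained in $\tau$.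 (1) Let $v$ be a vertex of $P$, and let $\tau_v$ be the cone of inward normal vectors of $P$ at $v$. It is a maximal cone of $\Sigma_P$. Call $Q$ a truncation of $P$ at $v$ if $Q=P\cap H$ for a closed half-space $H$ that does not contain $v$ and has all other vertices of $P$ in its interior. Every truncation $Q$ of $P$ at $v$ is a simple $n$-polytope, its normal fan is a star subdivision of $\Sigma_P$ at $\tau_v$, and its $g$-vector is $(1,g_1+1,g_2,\dots,g_{\lfloor n/2\rfloor})$. Moreover, for every $x$ in the interior of $\tau_v$, the star subdivision of $\Sigma_P$ at $\tau_v$ in the direction of $x$ is the normal fan of some truncation of $P$ at $v$. (2) If $Q\subset\mathbb{R}^n$ is any $n$-dimensional polytope whose normal fan is a star subdivision of $\Sigma_P$ at a maximal cone, then $Q$ is simple and its $g$-vector is $(1,g_1+1,g_2,\dots,g_{\lfloor n/2\rfloor})$. -/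

import Mathlib

/-- `P ⊆ ℝⁿ` is an `n`-dimensional convex polytope: the convex hull of a finite set of points,
of full dimension. -/
def IsFullPolytope {n : ℕ} (P : Set (Fin n → ℝ)) : Prop :=
  (∃ S : Finset (Fin n → ℝ), P = convexHull ℝ (S : Set (Fin n → ℝ))) ∧ affineSpan ℝ P = ⊤

/-- `P ⊆ ℝⁿ` is an `n`-dimensional lattice polytope: the convex hull of a finite set of points
of `ℤⁿ`, of full dimension. -/
def IsFullLatticePolytope {n : ℕ} (P : Set (Fin n → ℝ)) : Prop :=
  (∃ S : Finset (Fin n → ℤ),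
    P = convexHull ℝ ((fun (z : Fin n → ℤ) (i : Fin n) => (z i : ℝ)) '' (S : Set (Fin n → ℤ)))) ∧
  affineSpan ℝ P = ⊤

/-- The nonempty faces of `P`: the sets of points of `P` at which some linear functional is
maximal on `P`. The zero functional gives the face `P` itself. -/
def IsFace {n : ℕ} (P F : Set (Fin n → ℝ)) : Prop :=
  IsExposed ℝ P F ∧ F.Nonempty

/-- The dimension of a (nonempty) face: the dimension of its affine hull. -/
noncomputable def faceDim {n : ℕ} (F : Set (Fin n → ℝ)) : ℕ :=
  Module.finrank ℝ (vectorSpan ℝ F)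

/-- The vertices of `P`. -/
def IsVertex {n : ℕ} (P : Set (Fin n → ℝ)) (v : Fin n → ℝ) : Prop :=
  IsFace P {v}

/-- The edges of `P`: the one-dimensional faces. -/
def IsEdge {n : ℕ} (P E : Set (Fin n → ℝ)) : Prop :=
  IsFace P E ∧ faceDim E = 1

/-- An `n`-dimensional polytope is simple if exactly `n` edges meet at each vertex. -/
def IsSimplePolytope {n : ℕ} (P : Set (Fin n → ℝ)) : Prop :=
  ∀ v, IsVertex P v → {E | IsEdge P E ∧ v ∈ E}.ncard = n

/-- The primitive integer vectors along the edges of `P` that emanate from the point `v`. -/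
def edgeVectors {n : ℕ} (P : Set (Fin n → ℝ)) (v : Fin n → ℝ) : Set (Fin n → ℤ) :=
  {z | Finset.univ.gcd z = 1 ∧
    ∃ t : ℝ, 0 < t ∧ IsEdge P (segment ℝ v (v + t • (fun i => (z i : ℝ))))}

/-- Smooth polytopes: simple full-dimensional lattice polytopes such that, at each vertex, the
primitive vectors along the edges emanating from it form a basis of `ℤⁿ`. -/
def IsSmoothPolytope {n : ℕ} (P : Set (Fin n → ℝ)) : Prop :=
  IsFullLatticePolytope P ∧ IsSimplePolytope P ∧
  ∀ v, IsVertex P v →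
    ∃ b : Module.Basis (Fin n) ℤ (Fin n → ℤ), Set.range b = edgeVectors P v

/-- The `f`-vector with its index shifted by one: `fVector P k` is `f_{k-1}`. So
`fVector P 0 = f_{-1} = 1`, and for `1 ≤ k ≤ n` it is the number of faces of dimension `n - k`. -/
noncomputable def fVector {n : ℕ} (P : Set (Fin n → ℝ)) : ℕ → ℕ
  | 0 => 1
  | k + 1 => {F | IsFace P F ∧ faceDim F + (k + 1) = n}.ncard

/-- The polynomial `∑_{k=0}^n f_{k-1} (t - 1)^{n-k}`. -/
noncomputable def hPolynomial {n : ℕ} (P : Set (Fin n → ℝ)) : Polynomial ℤ :=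
  ∑ k ∈ Finset.range (n + 1),
    Polynomial.C (fVector P k : ℤ) * (Polynomial.X - 1) ^ (n - k)

/-- The `h`-vector (for `k ≤ n`), given by
`∑_{k=0}^n h_k t^{n-k} = ∑_{k=0}^n f_{k-1} (t - 1)^{n-k}`. -/
noncomputable def hVector {n : ℕ} (P : Set (Fin n → ℝ)) (k : ℕ) : ℤ :=
  (hPolynomial P).coeff (n - k)

/-- The `g`-vector (for `k ≤ n / 2`): `g_0 = 1` and `g_k = h_k - h_{k-1}` for `k ≥ 1`. -/
noncomputable def gVector {n : ℕ} (P : Set (Fin n → ℝ)) : ℕ → ℤ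
  | 0 => 1
  | k + 1 => hVector P (k + 1) - hVector P k

/-- The cone of inward normal vectors of `P` along `F`: the vectors `u` such that `⟨u, ·⟩`
is minimal on `P` at every point of `F`. -/
def normalCone {n : ℕ} (P F : Set (Fin n → ℝ)) : PointedCone ℝ (Fin n → ℝ) where
  carrier := {u | ∀ x ∈ F, ∀ y ∈ P, u ⬝ᵥ x ≤ u ⬝ᵥ y}
  zero_mem' := by
    intro x _ y _
    simp
  add_mem' := by
    intro a b ha hb x hx y hy
    rw [add_dotProduct, add_dotProduct]
    exact add_le_add (ha x hx y hy) (hb x hx y hy)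
  smul_mem' := by
    intro c a ha x hx y hy
    have h : (c • a : Fin n → ℝ) = (c : ℝ) • a := rfl
    rw [h, smul_dotProduct, smul_dotProduct]
    exact mul_le_mul_of_nonneg_left (ha x hx y hy) c.2

/-- The (inner) normal fan of a full-dimensional polytope: the set of the normal cones along
its nonempty faces. -/
def normalFan {n : ℕ} (P : Set (Fin n → ℝ)) : Set (PointedCone ℝ (Fin n → ℝ)) :=
  {σ | ∃ F, IsFace P F ∧ σ = normalCone P F}

/-- The star of a cone `τ` in a fan. -/
def coneStar {n : ℕ} (fan : Set (PointedCone ℝ (Fin n → ℝ))) (τ : PointedCone ℝ (Fin n → ℝ)) :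
    Set (PointedCone ℝ (Fin n → ℝ)) :=
  {σ | σ ∈ fan ∧ τ ≤ σ}

/-- The closed star of a cone `τ` in a fan. -/
def closedConeStar {n : ℕ} (fan : Set (PointedCone ℝ (Fin n → ℝ)))
    (τ : PointedCone ℝ (Fin n → ℝ)) : Set (PointedCone ℝ (Fin n → ℝ)) :=
  {φ | φ ∈ fan ∧ ∃ σ ∈ coneStar fan τ, φ ≤ σ}

/-- The star subdivision of a fan in the direction of a vector `x` in the (relative) interior of
its cone `τ`: the star of `τ` is replaced by the cones `pos (x, φ)`, for `φ` in the closed star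
but not in the star. -/
def starSubdivision {n : ℕ} (fan : Set (PointedCone ℝ (Fin n → ℝ)))
    (τ : PointedCone ℝ (Fin n → ℝ)) (x : Fin n → ℝ) : Set (PointedCone ℝ (Fin n → ℝ)) :=
  (fan \ coneStar fan τ) ∪
    {σ | ∃ φ ∈ closedConeStar fan τ \ coneStar fan τ, σ = PointedCone.hull ℝ {x} ⊔ φ}

/-- `fan'` is a star subdivision of `fan` at its cone `τ`. -/
def IsStarSubdivision {n : ℕ} (fan : Set (PointedCone ℝ (Fin n → ℝ)))
    (τ : PointedCone ℝ (Fin n → ℝ)) (fan' : Set (PointedCone ℝ (Fin n → ℝ))) : Prop :=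
  ∃ x ∈ intrinsicInterior ℝ (τ : Set (Fin n → ℝ)), fan' = starSubdivision fan τ x

/-- `Q` is obtained from `P` by truncating the vertex `v`: it is the part of `P` in a closed
half-space that does not contain `v` and has all other vertices of `P` in its interior. -/
def IsVertexTruncation {n : ℕ} (P : Set (Fin n → ℝ)) (v : Fin n → ℝ)
    (Q : Set (Fin n → ℝ)) : Prop :=
  ∃ (u : Fin n → ℝ) (c : ℝ), u ⬝ᵥ v < c ∧ (∀ w, IsVertex P w → w ≠ v → c < u ⬝ᵥ w) ∧
    Q = {x ∈ P | c ≤ u ⬝ᵥ x}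

/-! The whole argument takes place in the normal fan. Sending a nonempty face to its normal cone is
injective, reverses inclusion, and turns dimension into codimension (`normalCone_le_iff`,
`IsPolytope.coneDim_normalCone`). Hence the `f`-vector and simplicity can be read off the fan, and
both claims reduce to counting cones in a star subdivision.

For a truncation by ⟨u,·⟩ ≥ c, every face F ≠ {v} survives as its truncation, with the same normal
cone. Every face F ≠ {v} through v also produces a slice by the cutting hyperplane, with normal cone
pos(u, N(F)). There are no other faces: a functional whose minimum over P is at v can be tilted by a
multiple of u until a second vertex becomes minimal too. So the fan of the truncation is the star
subdivision in direction u (`CutsOff.normalFan_truncation`). Conversely, a vector in the interior of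
the cone at v is minimal at v only, so a suitable level set of it cuts off exactly v.

For the count, simplicity and the lattice basis at v give linear coordinates in which the cone at v
is the nonnegative orthant and its faces are the coordinate faces
(`IsSmoothPolytope.exists_orthantFace`). Subdividing removes one n-dimensional cone and adds one
cone of dimension |A|+1 for every proper subset A of the n coordinates. So f_j grows by C(n,j), less
one when j = n-1. In the `h`-polynomial this adds t + ... + t^(n-1): each h_k with 1 ≤ k ≤ n-1 grows
by one, so g_1 grows by one and the later g_k do not change. -/

/-- A convex hull of finitely many points. -/
def IsPolytope {n : ℕ} (P : Set (Fin n → ℝ)) : Prop :=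
  ∃ S : Finset (Fin n → ℝ), P = convexHull ℝ (S : Set (Fin n → ℝ))

/-! ### Faces, vertices and normal cones of a polytope. -/

/-- The set of points of `P` at which `⟨u, ·⟩` is minimal on `P`. -/
def minFace {n : ℕ} (P : Set (Fin n → ℝ)) (u : Fin n → ℝ) : Set (Fin n → ℝ) :=
  {x | x ∈ P ∧ ∀ y ∈ P, u ⬝ᵥ x ≤ u ⬝ᵥ y}

theorem strongDual_eq_dotProduct {n : ℕ} (l : StrongDual ℝ (Fin n → ℝ)) :
    ∃ u : Fin n → ℝ, ∀ x, l x = u ⬝ᵥ x := by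
  refine ⟨fun i => l (Pi.single i 1), fun x => ?_⟩
  have := LinearMap.pi_apply_eq_sum_univ (l : (Fin n → ℝ) →ₗ[ℝ] ℝ) x
  simp only [ContinuousLinearMap.coe_coe, smul_eq_mul] at this
  rw [this, dotProduct]
  refine Finset.sum_congr rfl fun i _ => ?_
  rw [mul_comm]
  congr 2
  ext j
  simp [Pi.single_apply, eq_comm]

theorem continuous_dotProduct_left {n : ℕ} (u : Fin n → ℝ) :
    Continuous fun x : Fin n → ℝ => u ⬝ᵥ x := by
  fun_prop

/-- Exposed faces are defined by maximizers; a change of sign turns them into minimizers, which suit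
inward normals. -/
theorem isFace_iff {n : ℕ} {P F : Set (Fin n → ℝ)} :
    IsFace P F ↔ F.Nonempty ∧ ∃ u, F = minFace P u := by
  constructor
  · rintro ⟨he, hne⟩
    refine ⟨hne, ?_⟩
    obtain ⟨l, hl⟩ := he hne
    obtain ⟨u, hu⟩ := strongDual_eq_dotProduct l
    refine ⟨-u, ?_⟩
    rw [hl]
    ext x
    simp [minFace, hu, neg_dotProduct]
  · rintro ⟨hne, u, rfl⟩
    refine ⟨fun _ => ?_, hne⟩
    refine ⟨-LinearMap.toContinuousLinearMap (dotProductBilin ℝ ℝ u), ?_⟩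
    ext x
    simp [minFace, dotProductBilin]

theorem isFace_minFace {n : ℕ} {P : Set (Fin n → ℝ)} {u : Fin n → ℝ}
    (h : (minFace P u).Nonempty) : IsFace P (minFace P u) :=
  isFace_iff.2 ⟨h, u, rfl⟩

theorem IsFace.subset {n : ℕ} {P F : Set (Fin n → ℝ)} (h : IsFace P F) : F ⊆ P :=
  h.1.subset

theorem IsVertex.mem {n : ℕ} {P : Set (Fin n → ℝ)} {v : Fin n → ℝ} (h : IsVertex P v) : v ∈ P :=
  h.subset rfl

theorem mem_normalCone_minFace {n : ℕ} {P : Set (Fin n → ℝ)} {u : Fin n → ℝ} :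
    u ∈ normalCone P (minFace P u) :=
  fun _ hx => hx.2

theorem IsFace.exists_mem_normalCone {n : ℕ} {P F : Set (Fin n → ℝ)} (h : IsFace P F) :
    ∃ u ∈ normalCone P F, F = minFace P u := by
  obtain ⟨_, u, rfl⟩ := isFace_iff.1 h
  exact ⟨u, mem_normalCone_minFace, rfl⟩

theorem normalCone_anti {n : ℕ} {P F G : Set (Fin n → ℝ)} (h : G ⊆ F) :
    normalCone P F ≤ normalCone P G :=
  fun _ hu x hx => hu x (h hx)

/-- The normal cone of a face contains that of another exactly if the faces are nested. -/
theorem normalCone_le_iff {n : ℕ} {P F G : Set (Fin n → ℝ)} (hF : IsFace P F) (hG : IsFace P G) :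
    normalCone P F ≤ normalCone P G ↔ G ⊆ F := by
  refine ⟨fun h => ?_, normalCone_anti⟩
  obtain ⟨u, hu, rfl⟩ := hF.exists_mem_normalCone
  exact fun x hx => ⟨hG.subset hx, h hu x hx⟩

theorem normalCone_injOn {n : ℕ} {P F G : Set (Fin n → ℝ)} (hF : IsFace P F) (hG : IsFace P G)
    (h : normalCone P F = normalCone P G) : F = G :=
  Set.Subset.antisymm ((normalCone_le_iff hG hF).1 h.ge) ((normalCone_le_iff hF hG).1 h.le)

theorem IsPolytope.isCompact {n : ℕ} {P : Set (Fin n → ℝ)} (h : IsPolytope P) : IsCompact P := by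
  obtain ⟨S, rfl⟩ := h
  exact S.finite_toSet.isCompact_convexHull ℝ

theorem IsPolytope.convex {n : ℕ} {P : Set (Fin n → ℝ)} (h : IsPolytope P) : Convex ℝ P := by
  obtain ⟨S, rfl⟩ := h
  exact convex_convexHull ℝ _

theorem convex_le_dotProduct {n : ℕ} (u : Fin n → ℝ) (c : ℝ) :
    Convex ℝ {x : Fin n → ℝ | c ≤ u ⬝ᵥ x} :=
  convex_halfSpace_ge (f := fun x => u ⬝ᵥ x)
    ⟨fun x y => dotProduct_add u x y, fun a x => dotProduct_smul a u x⟩ c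

theorem convex_lt_dotProduct {n : ℕ} (u : Fin n → ℝ) (c : ℝ) :
    Convex ℝ {x : Fin n → ℝ | c < u ⬝ᵥ x} :=
  convex_halfSpace_gt (f := fun x => u ⬝ᵥ x)
    ⟨fun x y => dotProduct_add u x y, fun a x => dotProduct_smul a u x⟩ c

theorem le_dotProduct_of_mem_convexHull {n : ℕ} {S : Set (Fin n → ℝ)} {u y : Fin n → ℝ} {c : ℝ}
    (h : ∀ s ∈ S, c ≤ u ⬝ᵥ s) (hy : y ∈ convexHull ℝ S) : c ≤ u ⬝ᵥ y :=
  convexHull_min (s := S) (t := {x | c ≤ u ⬝ᵥ x}) h (convex_le_dotProduct u c) hy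

theorem IsPolytope.minFace_nonempty {n : ℕ} {P : Set (Fin n → ℝ)} (h : IsPolytope P)
    (hne : P.Nonempty) (u : Fin n → ℝ) : (minFace P u).Nonempty := by
  obtain ⟨x, hx, hmin⟩ :=
    h.isCompact.exists_isMinOn hne (continuous_dotProduct_left u).continuousOn
  exact ⟨x, hx, fun y hy => hmin hy⟩

/-- Extreme points of a polytope are vertices. -/
theorem IsPolytope.isVertex_of_mem_extremePoints {n : ℕ} {P : Set (Fin n → ℝ)} (h : IsPolytope P)
    {v : Fin n → ℝ} (hv : v ∈ P.extremePoints ℝ) : IsVertex P v := by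
  obtain ⟨S, rfl⟩ := h
  have hvS : v ∈ (S : Set (Fin n → ℝ)) := extremePoints_convexHull_subset hv
  -- Otherwise v would be an extreme point of the smaller hull, hence one of its generators.
  have hnot : v ∉ convexHull ℝ ((S : Set (Fin n → ℝ)) \ {v}) := by
    intro hmem
    have := extremePoints_convexHull_subset
      (inter_extremePoints_subset_extremePoints_of_subset
        (convexHull_mono (Set.sdiff_subset (s := (S : Set (Fin n → ℝ))) (t := {v}))) ⟨hmem, hv⟩)
    exact this.2 rfl
  have hclosed : IsClosed (convexHull ℝ ((S : Set (Fin n → ℝ)) \ {v})) :=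
    (S.finite_toSet.subset Set.sdiff_subset).isClosed_convexHull ℝ
  obtain ⟨l, c, hl, hc⟩ := geometric_hahn_banach_point_closed (convex_convexHull ℝ _) hclosed hnot
  obtain ⟨u, hu⟩ := strongDual_eq_dotProduct l
  refine isFace_iff.2 ⟨Set.singleton_nonempty v, u, ?_⟩
  have hle : ∀ s ∈ (S : Set (Fin n → ℝ)), u ⬝ᵥ v ≤ u ⬝ᵥ s := by
    intro s hs
    by_cases hsv : s = v
    · rw [hsv]
    · rw [← hu, ← hu]
      exact (hl.trans (hc s (subset_convexHull ℝ _ ⟨hs, hsv⟩))).le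
  have hle' : ∀ y ∈ convexHull ℝ (S : Set (Fin n → ℝ)), u ⬝ᵥ v ≤ u ⬝ᵥ y :=
    fun y hy => le_dotProduct_of_mem_convexHull hle hy
  ext x
  simp only [Set.mem_singleton_iff]
  constructor
  · rintro rfl
    exact ⟨hv.1, hle'⟩
  · rintro ⟨hxP, hx⟩
    by_cases hne : ((S : Set (Fin n → ℝ)) \ {v}).Nonempty
    -- Each point of P lies on a segment from v to the hull of the other generators, where the
    -- separating functional is strictly larger; a minimizer gives that end weight zero.
    · rw [← Set.insert_sdiff_self_of_mem hvS, convexHull_insert hne, convexJoin_singleton_left]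
        at hxP
      simp only [Set.mem_iUnion] at hxP
      obtain ⟨y, hy, a, b, ha, hb, hab, rfl⟩ := hxP
      have h1 := hx v hv.1
      have h2 := hc y hy
      rw [hu] at h2 hl
      rw [dotProduct_add, dotProduct_smul, dotProduct_smul, smul_eq_mul, smul_eq_mul] at h1
      have hb0 : b = 0 := by
        by_contra hb'
        have : 0 < b := lt_of_le_of_ne hb (Ne.symm hb')
        have ha' : a = 1 - b := by linarith
        subst ha'
        nlinarith
      subst hb0
      have : a = 1 := by linarith
      simp [this]
    · rw [Set.not_nonempty_iff_eq_empty, Set.sdiff_eq_empty] at hne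
      have hS : (S : Set (Fin n → ℝ)) = {v} :=
        Set.Subset.antisymm hne (Set.singleton_subset_iff.2 hvS)
      rw [hS, convexHull_singleton] at hxP
      exact hxP

theorem IsVertex.mem_extremePoints {n : ℕ} {P : Set (Fin n → ℝ)} {v : Fin n → ℝ}
    (h : IsVertex P v) : v ∈ P.extremePoints ℝ :=
  isExtreme_singleton.1 h.1.isExtreme

theorem IsPolytope.finite_vertices {n : ℕ} {P : Set (Fin n → ℝ)} (h : IsPolytope P) :
    {v | IsVertex P v}.Finite := by
  obtain ⟨S, rfl⟩ := h
  exact S.finite_toSet.subset fun v hv => extremePoints_convexHull_subset hv.mem_extremePoints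

/-- A compact convex extreme subset of a polytope is the convex hull of the vertices it contains. -/
theorem IsPolytope.eq_convexHull_vertices {n : ℕ} {P F : Set (Fin n → ℝ)} (h : IsPolytope P)
    (hF : IsExtreme ℝ P F) (hc : IsCompact F) (hconv : Convex ℝ F) :
    F = convexHull ℝ {v | IsVertex P v ∧ v ∈ F} := by
  apply Set.Subset.antisymm
  · have hfin : {v | IsVertex P v ∧ v ∈ F}.Finite := h.finite_vertices.subset fun v hv => hv.1
    have hsub : F.extremePoints ℝ ⊆ {v | IsVertex P v ∧ v ∈ F} := fun v hv =>
      ⟨h.isVertex_of_mem_extremePoints (hF.extremePoints_subset_extremePoints hv), hv.1⟩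
    calc F = closure (convexHull ℝ (F.extremePoints ℝ)) :=
          (closure_convexHull_extremePoints hc hconv).symm
      _ ⊆ closure (convexHull ℝ {v | IsVertex P v ∧ v ∈ F}) := closure_mono (convexHull_mono hsub)
      _ = _ := (hfin.isClosed_convexHull ℝ).closure_eq
  · exact convexHull_min (fun v hv => hv.2) hconv

theorem IsPolytope.face_isCompact {n : ℕ} {P F : Set (Fin n → ℝ)} (h : IsPolytope P)
    (hF : IsFace P F) : IsCompact F :=
  hF.1.isCompact h.isCompact

theorem IsPolytope.face_convex {n : ℕ} {P F : Set (Fin n → ℝ)} (h : IsPolytope P)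
    (hF : IsFace P F) : Convex ℝ F :=
  hF.1.convex h.convex

theorem IsPolytope.face_eq_convexHull {n : ℕ} {P F : Set (Fin n → ℝ)} (h : IsPolytope P)
    (hF : IsFace P F) : F = convexHull ℝ {v | IsVertex P v ∧ v ∈ F} :=
  h.eq_convexHull_vertices hF.1.isExtreme (h.face_isCompact hF) (h.face_convex hF)

theorem IsPolytope.eq_convexHull {n : ℕ} {P : Set (Fin n → ℝ)} (h : IsPolytope P) :
    P = convexHull ℝ {v | IsVertex P v} := by
  conv_lhs => rw [h.eq_convexHull_vertices (IsExtreme.refl ℝ P) h.isCompact h.convex]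
  congr 1
  ext v
  exact ⟨fun hv => hv.1, fun hv => ⟨hv, hv.mem⟩⟩

theorem IsPolytope.finite_faces {n : ℕ} {P : Set (Fin n → ℝ)} (h : IsPolytope P) :
    {F | IsFace P F}.Finite := by
  refine (h.finite_vertices.finite_subsets.image (convexHull ℝ)).subset fun F hF => ?_
  exact ⟨{v | IsVertex P v ∧ v ∈ F}, fun v hv => hv.1, (h.face_eq_convexHull hF).symm⟩

theorem IsPolytope.exists_vertex_ne {n : ℕ} {P F : Set (Fin n → ℝ)} (h : IsPolytope P)
    (hF : IsFace P F) {v : Fin n → ℝ} (hv : F ≠ {v}) : ∃ w ∈ F, IsVertex P w ∧ w ≠ v := by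
  by_contra! hcon
  have hsub : F ⊆ {v} := by
    rw [h.face_eq_convexHull hF]
    exact convexHull_min (fun w hw => hcon w hw.2 hw.1) (convex_singleton v)
  exact hv (hF.2.subset_singleton_iff.1 hsub)

theorem IsPolytope.exists_vertex_mem {n : ℕ} {P F : Set (Fin n → ℝ)} (h : IsPolytope P)
    (hF : IsFace P F) : ∃ w ∈ F, IsVertex P w := by
  obtain ⟨w, hw⟩ := (h.face_isCompact hF).extremePoints_nonempty hF.2
  exact ⟨w, hw.1, h.isVertex_of_mem_extremePoints
    (hF.1.isExtreme.extremePoints_subset_extremePoints hw)⟩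

/-- A small perturbation of a functional, by one that is constant on its face of minimizers, stays
in the normal cone of that face. -/
theorem IsPolytope.exists_add_smul_mem_normalCone {n : ℕ} {P : Set (Fin n → ℝ)}
    (h : IsPolytope P) {u w : Fin n → ℝ}
    (hw : ∀ x ∈ minFace P u, ∀ y ∈ minFace P u, w ⬝ᵥ x = w ⬝ᵥ y) :
    ∃ ε : ℝ, 0 < ε ∧ u + ε • w ∈ normalCone P (minFace P u) := by
  by_cases hne : (minFace P u).Nonempty
  swap
  · rw [Set.not_nonempty_iff_eq_empty] at hne
    exact ⟨1, one_pos, by rw [hne]; exact fun x hx => hx.elim⟩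
  obtain ⟨p, hp⟩ := hne
  obtain ⟨S, rfl⟩ := h
  -- Only the finitely many generators matter. On the face the perturbation is constant; off it the
  -- strict inequality persists for small ε.
  have key : ∀ᶠ ε : ℝ in nhdsWithin 0 (Set.Ioi 0),
      ∀ s ∈ S, (u + ε • w) ⬝ᵥ p ≤ (u + ε • w) ⬝ᵥ s := by
    rw [Filter.eventually_all_finset]
    intro s hs
    have hsP : s ∈ convexHull ℝ (S : Set (Fin n → ℝ)) := subset_convexHull ℝ _ hs
    by_cases hsF : s ∈ minFace (convexHull ℝ (S : Set (Fin n → ℝ))) u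
    · refine Filter.Eventually.of_forall fun ε => ?_
      rw [add_dotProduct, add_dotProduct, smul_dotProduct, smul_dotProduct, hw p hp s hsF]
      have := hp.2 s hsP
      linarith
    · have hlt : u ⬝ᵥ p < u ⬝ᵥ s := by
        refine lt_of_le_of_ne (hp.2 s hsP) fun heq => hsF ⟨hsP, fun y hy => ?_⟩
        rw [← heq]
        exact hp.2 y hy
      have hc1 : Continuous fun ε : ℝ => (u + ε • w) ⬝ᵥ p := by fun_prop
      have hc2 : Continuous fun ε : ℝ => (u + ε • w) ⬝ᵥ s := by fun_prop
      have : ∀ᶠ ε : ℝ in nhds 0, (u + ε • w) ⬝ᵥ p < (u + ε • w) ⬝ᵥ s :=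
        hc1.continuousAt.eventually_lt hc2.continuousAt (by simpa using hlt)
      exact (this.filter_mono nhdsWithin_le_nhds).mono fun ε hε => hε.le
  obtain ⟨ε, hε, hε0⟩ := (key.and self_mem_nhdsWithin).exists
  refine ⟨ε, hε0, fun x hx y hy => ?_⟩
  have h1 : (u + ε • w) ⬝ᵥ x = (u + ε • w) ⬝ᵥ p := by
    rw [add_dotProduct, add_dotProduct, smul_dotProduct, smul_dotProduct, hw x hx p hp,
      le_antisymm (hx.2 p hp.1) (hp.2 x hx.1)]
  rw [h1]
  exact le_dotProduct_of_mem_convexHull hε hy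

/-! ### Dimensions of faces and of their normal cones. -/

/-- The dimension of the linear span of a cone. -/
noncomputable def coneDim {n : ℕ} (σ : PointedCone ℝ (Fin n → ℝ)) : ℕ :=
  Module.finrank ℝ (Submodule.span ℝ (σ : Set (Fin n → ℝ)))

/-- A functional w constant on the face is a multiple of the difference of two normal vectors: the
exposing vector u and its perturbation u + εw. -/
theorem IsPolytope.mem_span_normalCone {n : ℕ} {P F : Set (Fin n → ℝ)} (h : IsPolytope P)
    (hF : IsFace P F) {w : Fin n → ℝ} :
    w ∈ Submodule.span ℝ (normalCone P F : Set (Fin n → ℝ)) ↔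
      ∀ x ∈ F, ∀ y ∈ F, w ⬝ᵥ x = w ⬝ᵥ y := by
  constructor
  · intro hw x hx y hy
    induction hw using Submodule.span_induction with
    | mem u hu => exact le_antisymm (hu x hx y (hF.subset hy)) (hu y hy x (hF.subset hx))
    | zero => simp
    | add a b _ _ ha hb => rw [add_dotProduct, add_dotProduct, ha, hb]
    | smul c a _ ha => rw [smul_dotProduct, smul_dotProduct, ha]
  · intro hw
    obtain ⟨u, hu, rfl⟩ := hF.exists_mem_normalCone
    obtain ⟨ε, hε, hmem⟩ := h.exists_add_smul_mem_normalCone hw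
    have : w = ε⁻¹ • ((u + ε • w) - u) := by
      rw [add_sub_cancel_left, smul_smul, inv_mul_cancel₀ hε.ne', one_smul]
    rw [this]
    exact Submodule.smul_mem _ _
      (Submodule.sub_mem _ (Submodule.subset_span hmem) (Submodule.subset_span hu))

theorem IsPolytope.coneDim_normalCone {n : ℕ} {P F : Set (Fin n → ℝ)} (h : IsPolytope P)
    (hF : IsFace P F) : faceDim F + coneDim (normalCone P F) = n := by
  have hspan : Submodule.span ℝ (normalCone P F : Set (Fin n → ℝ)) =
      (vectorSpan ℝ F).dualAnnihilator.map
        ((dotProductEquiv ℝ (Fin n)).symm : Module.Dual ℝ (Fin n → ℝ) →ₗ[ℝ] Fin n → ℝ) := by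
    ext w
    rw [h.mem_span_normalCone hF, Submodule.mem_map_equiv, LinearEquiv.symm_symm,
      Submodule.mem_dualAnnihilator]
    constructor
    · intro hw d hd
      rw [vectorSpan_def] at hd
      induction hd using Submodule.span_induction with
      | mem d hd =>
        obtain ⟨x, hx, y, hy, rfl⟩ := hd
        have := hw x hx y hy
        simp [dotProduct_sub, this]
      | zero => simp
      | add a b _ _ ha hb => rw [map_add, ha, hb, add_zero]
      | smul c a _ ha => rw [map_smul, ha, smul_zero]
    · intro hw x hx y hy
      have := hw _ (vsub_mem_vectorSpan ℝ hx hy)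
      rw [dotProductEquiv_apply_apply, vsub_eq_sub, dotProduct_sub] at this
      linarith
  have := Subspace.finrank_add_finrank_dualAnnihilator_eq (vectorSpan ℝ F)
  rw [Module.finrank_fin_fun] at this
  rw [coneDim, hspan, faceDim, LinearEquiv.finrank_map_eq, this]

/-- Equal dimensions force equal direction spaces, so the functional exposing F is constant on G as
well. -/
theorem IsFace.eq_of_subset_of_faceDim_eq {n : ℕ} {P F G : Set (Fin n → ℝ)}
    (hF : IsFace P F) (hG : IsFace P G) (hle : F ⊆ G)
    (hd : faceDim F = faceDim G) : F = G := by
  refine Set.Subset.antisymm hle ?_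
  have hspan : vectorSpan ℝ F = vectorSpan ℝ G :=
    Submodule.eq_of_le_of_finrank_eq (vectorSpan_mono ℝ hle) hd
  obtain ⟨u, hu, hFu⟩ := hF.exists_mem_normalCone
  obtain ⟨p, hp⟩ := hF.2
  intro x hx
  have hxp : x - p ∈ vectorSpan ℝ F := by
    rw [hspan]
    exact vsub_mem_vectorSpan ℝ hx (hle hp)
  have hz : u ⬝ᵥ (x - p) = 0 := by
    rw [vectorSpan_def] at hxp
    generalize x - p = d at hxp
    induction hxp using Submodule.span_induction with
    | mem d hd =>
      obtain ⟨a, ha, b, hb, rfl⟩ := hd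
      have := le_antisymm (hu a ha b (hF.subset hb)) (hu b hb a (hF.subset ha))
      simp [dotProduct_sub, this]
    | zero => simp
    | add a b _ _ ha hb => rw [dotProduct_add, ha, hb, add_zero]
    | smul c a _ ha => rw [dotProduct_smul, ha, smul_zero]
  rw [dotProduct_sub, sub_eq_zero] at hz
  rw [hFu]
  refine ⟨hG.subset hx, fun y hy => ?_⟩
  rw [hz]
  exact hu p hp y hy

/-! ### Cones at vertices: interiors and maximality. -/

/-- If x ≠ v were another minimizer, moving u slightly against x - v would make x beat v.
Conversely, a unique minimum amounts to finitely many strict inequalities on generators, an open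
condition. -/
theorem IsPolytope.mem_interior_normalCone_iff {n : ℕ} {P : Set (Fin n → ℝ)} (h : IsPolytope P)
    {v : Fin n → ℝ} (hv : v ∈ P) {u : Fin n → ℝ} :
    u ∈ interior (normalCone P {v} : Set (Fin n → ℝ)) ↔ minFace P u = {v} := by
  constructor
  · intro hu
    apply Set.Subset.antisymm
    · rintro x ⟨hxP, hx⟩
      by_contra hxv
      have hpos : 0 < (x - v) ⬝ᵥ (x - v) := by
        refine lt_of_le_of_ne (Finset.sum_nonneg fun i _ => mul_self_nonneg _) fun h0 => hxv ?_
        exact sub_eq_zero.1 (dotProduct_self_eq_zero.1 h0.symm)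
      have hcont : Continuous fun ε : ℝ => u - ε • (x - v) := by fun_prop
      have hev : ∀ᶠ ε : ℝ in nhds 0, u - ε • (x - v) ∈ (normalCone P {v} : Set (Fin n → ℝ)) := by
        have : u - (0 : ℝ) • (x - v) ∈ interior (normalCone P {v} : Set (Fin n → ℝ)) := by
          simpa using hu
        exact hcont.continuousAt.eventually_mem (mem_interior_iff_mem_nhds.1 this)
      obtain ⟨ε, hε, hε0⟩ :=
        ((hev.filter_mono nhdsWithin_le_nhds).and (self_mem_nhdsWithin (s := Set.Ioi 0))).exists
      have h1 := hε v rfl x hxP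
      have h2 := hx v hv
      have h3 : (u - ε • (x - v)) ⬝ᵥ (x - v) = u ⬝ᵥ (x - v) - ε * ((x - v) ⬝ᵥ (x - v)) := by
        rw [sub_dotProduct, smul_dotProduct, smul_eq_mul]
      have h4 : (u - ε • (x - v)) ⬝ᵥ (x - v) =
          (u - ε • (x - v)) ⬝ᵥ x - (u - ε • (x - v)) ⬝ᵥ v := dotProduct_sub _ _ _
      have h5 : u ⬝ᵥ (x - v) = u ⬝ᵥ x - u ⬝ᵥ v := dotProduct_sub _ _ _
      have h6 : 0 < ε * ((x - v) ⬝ᵥ (x - v)) := mul_pos hε0 hpos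
      linarith
    · rintro x rfl
      exact ⟨hv, interior_subset hu x rfl⟩
  · intro hu
    obtain ⟨S, rfl⟩ := h
    rw [mem_interior_iff_mem_nhds]
    have key : ∀ᶠ w : Fin n → ℝ in nhds u, ∀ s ∈ S, w ⬝ᵥ v ≤ w ⬝ᵥ s := by
      rw [Filter.eventually_all_finset]
      intro s hs
      have hsP : s ∈ convexHull ℝ (S : Set (Fin n → ℝ)) := subset_convexHull ℝ _ hs
      have hvF : v ∈ minFace (convexHull ℝ (S : Set (Fin n → ℝ))) u := by rw [hu]; rfl
      by_cases hsv : s = v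
      · exact Filter.Eventually.of_forall fun w => by rw [hsv]
      · have hlt : u ⬝ᵥ v < u ⬝ᵥ s := by
          refine lt_of_le_of_ne (hvF.2 s hsP) fun heq => hsv ?_
          have : s ∈ minFace (convexHull ℝ (S : Set (Fin n → ℝ))) u :=
            ⟨hsP, fun y hy => heq ▸ hvF.2 y hy⟩
          rw [hu] at this
          exact this
        have hc1 : Continuous fun w : Fin n → ℝ => w ⬝ᵥ v := by fun_prop
        have hc2 : Continuous fun w : Fin n → ℝ => w ⬝ᵥ s := by fun_prop
        exact (hc1.continuousAt.eventually_lt hc2.continuousAt hlt).mono fun w hw => hw.le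
    filter_upwards [key] with w hw
    rintro x rfl y hy
    exact le_dotProduct_of_mem_convexHull hw hy

theorem intrinsicInterior_eq_interior_of_nonempty {n : ℕ} {s : Set (Fin n → ℝ)}
    (hs : (interior s).Nonempty) : intrinsicInterior ℝ s = interior s := by
  refine Set.Subset.antisymm ?_ interior_subset_intrinsicInterior
  have htop : affineSpan ℝ s = ⊤ := affineSpan_eq_top_of_nonempty_interior
    (hs.mono (interior_mono (subset_convexHull ℝ s)))
  intro x hx
  obtain ⟨y, hy, rfl⟩ := mem_intrinsicInterior.1 hx
  have hopen : IsOpen ((affineSpan ℝ s : AffineSubspace ℝ (Fin n → ℝ)) : Set (Fin n → ℝ)) := by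
    rw [htop]
    exact isOpen_univ
  have hemb := hopen.isOpenEmbedding_subtypeVal
  have := hemb.isOpenMap.image_interior_subset _ (Set.mem_image_of_mem _ hy)
  exact interior_mono (Set.image_preimage_subset _ _) this

/-- The relative interior of the normal cone at a vertex consists of the functionals that are
minimal at this vertex only. -/
theorem IsPolytope.mem_intrinsicInterior_normalCone_iff {n : ℕ} {P : Set (Fin n → ℝ)}
    (h : IsPolytope P) {v : Fin n → ℝ} (hv : IsVertex P v) {u : Fin n → ℝ} :
    u ∈ intrinsicInterior ℝ (normalCone P {v} : Set (Fin n → ℝ)) ↔ minFace P u = {v} := by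
  obtain ⟨u', _, hu'⟩ := hv.exists_mem_normalCone
  rw [intrinsicInterior_eq_interior_of_nonempty
    ⟨u', (h.mem_interior_normalCone_iff hv.mem).2 hu'.symm⟩, h.mem_interior_normalCone_iff hv.mem]

theorem maximal_normalCone_vertex {n : ℕ} {P : Set (Fin n → ℝ)} {v : Fin n → ℝ}
    (hv : IsVertex P v) : Maximal (fun σ => σ ∈ normalFan P) (normalCone P {v}) := by
  refine ⟨⟨{v}, hv, rfl⟩, ?_⟩
  rintro _ ⟨F, hF, rfl⟩ hle
  have hsub := (normalCone_le_iff hv hF).1 hle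
  rw [hF.2.subset_singleton_iff.1 hsub]

theorem IsPolytope.exists_vertex_of_maximal {n : ℕ} {P : Set (Fin n → ℝ)} (h : IsPolytope P)
    {τ : PointedCone ℝ (Fin n → ℝ)} (hτ : Maximal (fun σ => σ ∈ normalFan P) τ) :
    ∃ v, IsVertex P v ∧ τ = normalCone P {v} := by
  obtain ⟨F, hF, rfl⟩ := hτ.1
  obtain ⟨v, hvF, hv⟩ := h.exists_vertex_mem hF
  have hle : normalCone P F ≤ normalCone P {v} :=
    normalCone_anti (Set.singleton_subset_iff.2 hvF)
  exact ⟨v, hv, le_antisymm hle (hτ.2 ⟨{v}, hv, rfl⟩ hle)⟩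

/-! ### Star subdivisions at a maximal cone. -/

/-- The star of a maximal cone is the cone alone, and its closed star consists of the fan's cones
contained in it. -/
theorem mem_starSubdivision_iff {n : ℕ} {fan : Set (PointedCone ℝ (Fin n → ℝ))}
    {τ σ : PointedCone ℝ (Fin n → ℝ)} {x : Fin n → ℝ} (hτ : Maximal (fun σ => σ ∈ fan) τ) :
    σ ∈ starSubdivision fan τ x ↔ (σ ∈ fan ∧ σ ≠ τ) ∨
      ∃ φ ∈ fan, φ ≤ τ ∧ φ ≠ τ ∧ σ = PointedCone.hull ℝ {x} ⊔ φ := by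
  have hstar : ∀ ψ, ψ ∈ coneStar fan τ ↔ ψ = τ := fun ψ =>
    ⟨fun hψ => le_antisymm (hτ.2 hψ.1 hψ.2) hψ.2, fun hψ => by rw [hψ]; exact ⟨hτ.1, le_rfl⟩⟩
  have hclosed : ∀ ψ, ψ ∈ closedConeStar fan τ ↔ ψ ∈ fan ∧ ψ ≤ τ := by
    intro ψ
    constructor
    · rintro ⟨hψ, ρ, hρ, hle⟩
      exact ⟨hψ, (hstar ρ).1 hρ ▸ hle⟩
    · rintro ⟨hψ, hle⟩
      exact ⟨hψ, τ, (hstar τ).2 rfl, hle⟩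
  simp only [starSubdivision, Set.mem_union, Set.mem_sdiff, Set.mem_ofPred_eq, hstar, hclosed,
    and_assoc]

theorem mem_hull_singleton_sup {n : ℕ} {φ : PointedCone ℝ (Fin n → ℝ)} {x y : Fin n → ℝ} :
    y ∈ PointedCone.hull ℝ {x} ⊔ φ ↔ ∃ a : ℝ, 0 ≤ a ∧ ∃ w ∈ φ, y = a • x + w := by
  rw [Submodule.mem_sup]
  constructor
  · rintro ⟨z, hz, w, hw, rfl⟩
    obtain ⟨a, rfl⟩ := Submodule.mem_span_singleton.1 hz
    exact ⟨a, a.2, w, hw, rfl⟩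
  · rintro ⟨a, ha, w, hw, rfl⟩
    exact ⟨a • x, Submodule.mem_span_singleton.2 ⟨⟨a, ha⟩, rfl⟩, w, hw, rfl⟩

/-! ### Faces and normal cones of a truncation. -/

/-- The part of `P` in the half-space where `⟨u, ·⟩` is at least `c`. -/
def truncation {n : ℕ} (P : Set (Fin n → ℝ)) (u : Fin n → ℝ) (c : ℝ) : Set (Fin n → ℝ) :=
  {x ∈ P | c ≤ u ⬝ᵥ x}

/-- The half-space `⟨u, ·⟩ ≥ c` cuts off precisely the vertex `v` of `P`. -/
structure CutsOff {n : ℕ} (P : Set (Fin n → ℝ)) (v u : Fin n → ℝ) (c : ℝ) : Prop where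
  isVertex : IsVertex P v
  lt : u ⬝ᵥ v < c
  lt_of_ne : ∀ w, IsVertex P w → w ≠ v → c < u ⬝ᵥ w

theorem dotProduct_combo {n : ℕ} (u x y : Fin n → ℝ) (a b : ℝ) :
    u ⬝ᵥ (a • x + b • y) = a * u ⬝ᵥ x + b * u ⬝ᵥ y := by
  rw [dotProduct_add, dotProduct_smul, dotProduct_smul, smul_eq_mul, smul_eq_mul]

theorem exists_combo_dotProduct_eq {n : ℕ} {u x y : Fin n → ℝ} {c : ℝ} (hx : u ⬝ᵥ x < c)
    (hy : c < u ⬝ᵥ y) : ∃ a b : ℝ, 0 < a ∧ 0 < b ∧ a + b = 1 ∧ u ⬝ᵥ (a • x + b • y) = c := by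
  have h : 0 < u ⬝ᵥ y - u ⬝ᵥ x := by linarith
  refine ⟨(u ⬝ᵥ y - c) / (u ⬝ᵥ y - u ⬝ᵥ x), (c - u ⬝ᵥ x) / (u ⬝ᵥ y - u ⬝ᵥ x),
    div_pos (by linarith) h, div_pos (by linarith) h, ?_, ?_⟩
  · field_simp
    ring
  · rw [dotProduct_combo]
    field_simp
    ring

theorem exists_combo_le_dotProduct {n : ℕ} {u y : Fin n → ℝ} {c : ℝ} (x : Fin n → ℝ)
    (hy : c < u ⬝ᵥ y) : ∃ a b : ℝ, 0 < a ∧ 0 < b ∧ a + b = 1 ∧ c ≤ u ⬝ᵥ (a • x + b • y) := by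
  rcases lt_or_ge (u ⬝ᵥ x) c with hx | hx
  · obtain ⟨a, b, ha, hb, hab, h⟩ := exists_combo_dotProduct_eq hx hy
    exact ⟨a, b, ha, hb, hab, h.ge⟩
  · refine ⟨1 / 2, 1 / 2, by norm_num, by norm_num, by norm_num, ?_⟩
    rw [dotProduct_combo]
    linarith

theorem CutsOff.minFace_eq {n : ℕ} {P : Set (Fin n → ℝ)} {v u : Fin n → ℝ} {c : ℝ}
    (hc : CutsOff P v u c) (h : IsPolytope P) : minFace P u = {v} := by
  by_contra hne
  obtain ⟨w, hw, hwv, hwne⟩ := h.exists_vertex_ne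
    (isFace_minFace (h.minFace_nonempty ⟨v, hc.isVertex.mem⟩ u)) hne
  have h1 := hw.2 v hc.isVertex.mem
  have h2 := hc.lt_of_ne w hwv hwne
  have h3 := hc.lt
  linarith

theorem CutsOff.exists_lt_of_ne {n : ℕ} {P F : Set (Fin n → ℝ)} {v u : Fin n → ℝ} {c : ℝ}
    (hc : CutsOff P v u c) (h : IsPolytope P) (hF : IsFace P F) (hne : F ≠ {v}) :
    ∃ z ∈ F, c < u ⬝ᵥ z := by
  obtain ⟨w, hw, hwv, hwne⟩ := h.exists_vertex_ne hF hne
  exact ⟨w, hw, hc.lt_of_ne w hwv hwne⟩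

theorem minFace_truncation {n : ℕ} {P : Set (Fin n → ℝ)} {u w : Fin n → ℝ} {c : ℝ}
    (hz : ∃ z ∈ minFace P w, c < u ⬝ᵥ z) :
    minFace (truncation P u c) w = truncation (minFace P w) u c := by
  obtain ⟨z, hz, hzc⟩ := hz
  ext x
  constructor
  · rintro ⟨hx, hmin⟩
    exact ⟨⟨hx.1, fun y hy => (hmin z ⟨hz.1, hzc.le⟩).trans (hz.2 y hy)⟩, hx.2⟩
  · rintro ⟨hx, hxc⟩
    exact ⟨⟨hx.1, hxc⟩, fun y hy => hx.2 y hy.1⟩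

/-- The segment from any point towards z enters the half-space before reaching it, so inequalities
on the truncation extend to all of P and F. -/
theorem normalCone_truncation {n : ℕ} {P F : Set (Fin n → ℝ)} {u : Fin n → ℝ} {c : ℝ}
    (hP : Convex ℝ P) (hF : Convex ℝ F) (hFP : F ⊆ P) (hz : ∃ z ∈ F, c < u ⬝ᵥ z) :
    normalCone (truncation P u c) (truncation F u c) = normalCone P F := by
  obtain ⟨z, hz, hzc⟩ := hz
  ext w
  constructor
  · intro hw x hx y hy
    have h1 : w ⬝ᵥ z ≤ w ⬝ᵥ y := by
      obtain ⟨a, b, ha, hb, hab, hp⟩ := exists_combo_le_dotProduct y hzc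
      have := hw z ⟨hz, hzc.le⟩ _ ⟨hP hy (hFP hz) ha.le hb.le hab, hp⟩
      rw [dotProduct_combo] at this
      have hb' : b = 1 - a := by linarith
      subst hb'
      have : a * w ⬝ᵥ z ≤ a * w ⬝ᵥ y := by linarith
      exact le_of_mul_le_mul_left this ha
    have h2 : w ⬝ᵥ x ≤ w ⬝ᵥ z := by
      obtain ⟨a, b, ha, hb, hab, hp⟩ := exists_combo_le_dotProduct x hzc
      have := hw _ ⟨hF hx hz ha.le hb.le hab, hp⟩ z ⟨hFP hz, hzc.le⟩
      rw [dotProduct_combo] at this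
      have hb' : b = 1 - a := by linarith
      subst hb'
      have : a * w ⬝ᵥ x ≤ a * w ⬝ᵥ z := by linarith
      exact le_of_mul_le_mul_left this ha
    exact h2.trans h1
  · intro hw x hx y hy
    exact hw x hx.1 y hy.1

/-- On the truncation both summands are bounded below, by a·c and by the minimum of w. The point g
where the segment from v to z crosses the hyperplane attains both bounds, so the minimizers are the
points attaining both. -/
theorem minFace_smul_add_truncation {n : ℕ} {P : Set (Fin n → ℝ)} {u v w : Fin n → ℝ} {a c : ℝ}
    (hP : Convex ℝ P) (ha : 0 < a) (hvc : u ⬝ᵥ v < c) (hv : v ∈ minFace P w)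
    (hz : ∃ z ∈ minFace P w, c < u ⬝ᵥ z) :
    minFace (truncation P u c) (a • u + w) = {x ∈ minFace P w | u ⬝ᵥ x = c} ∧
      {x ∈ minFace P w | u ⬝ᵥ x = c}.Nonempty := by
  obtain ⟨z, hz, hzc⟩ := hz
  obtain ⟨s, t, hs, ht, hst, hg⟩ := exists_combo_dotProduct_eq hvc hzc
  set g := s • v + t • z with hgdef
  have hgP : g ∈ P := hP hv.1 hz.1 hs.le ht.le hst
  have hgF : g ∈ minFace P w := by
    refine ⟨hgP, fun y hy => ?_⟩
    rw [hgdef, dotProduct_combo]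
    have h1 := hv.2 y hy
    have h2 := hz.2 y hy
    have hs' : s = 1 - t := by linarith
    subst hs'
    nlinarith
  refine ⟨?_, g, hgF, hg⟩
  have hexp : ∀ y, (a • u + w) ⬝ᵥ y = a * u ⬝ᵥ y + w ⬝ᵥ y := fun y => by
    rw [add_dotProduct, smul_dotProduct, smul_eq_mul]
  ext x
  constructor
  · rintro ⟨hx, hmin⟩
    have h1 := hmin g ⟨hgP, hg.ge⟩
    rw [hexp, hexp, hg] at h1
    have h2 := hgF.2 x hx.1
    have h3 : a * c ≤ a * u ⬝ᵥ x := mul_le_mul_of_nonneg_left hx.2 ha.le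
    refine ⟨⟨hx.1, fun y hy => ?_⟩, ?_⟩
    · have := hgF.2 y hy
      linarith
    · have : a * u ⬝ᵥ x = a * c := by linarith
      exact mul_left_cancel₀ ha.ne' this
  · rintro ⟨hx, hxc⟩
    refine ⟨⟨hx.1, hxc.ge⟩, fun y hy => ?_⟩
    rw [hexp, hexp, hxc]
    have h1 := hx.2 y hy.1
    have h2 : a * c ≤ a * u ⬝ᵥ y := mul_le_mul_of_nonneg_left hy.2 ha.le
    linarith

theorem normalCone_truncation_slice {n : ℕ} {P F : Set (Fin n → ℝ)} {u v : Fin n → ℝ} {c : ℝ}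
    (hP : Convex ℝ P) (hF : Convex ℝ F) (hFP : F ⊆ P) (hvc : u ⬝ᵥ v < c) (hv : v ∈ F)
    (hz : ∃ z ∈ F, c < u ⬝ᵥ z) :
    normalCone (truncation P u c) {x ∈ F | u ⬝ᵥ x = c} =
      PointedCone.hull ℝ {u} ⊔ normalCone P F := by
  obtain ⟨z, hz, hzc⟩ := hz
  obtain ⟨s, t, hs, ht, hst, hg⟩ := exists_combo_dotProduct_eq hvc hzc
  set g := s • v + t • z with hgdef
  have hgF : g ∈ F := hF hv hz hs.le ht.le hst
  ext w
  rw [mem_hull_singleton_sup]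
  constructor
  · intro hw
    -- This coefficient makes w' = w - a•u take the same value at v and z, hence at g.
    set a : ℝ := (w ⬝ᵥ z - w ⬝ᵥ v) / (u ⬝ᵥ z - u ⬝ᵥ v) with hadef
    have hden : 0 < u ⬝ᵥ z - u ⬝ᵥ v := by linarith
    have hgz : w ⬝ᵥ g ≤ w ⬝ᵥ z := hw g ⟨hgF, hg⟩ z ⟨hFP hz, hzc.le⟩
    have ha : 0 ≤ a := by
      refine div_nonneg ?_ hden.le
      rw [hgdef, dotProduct_combo] at hgz
      have ht' : t = 1 - s := by linarith
      subst ht'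
      have : s * w ⬝ᵥ v ≤ s * w ⬝ᵥ z := by linarith
      have := le_of_mul_le_mul_left this hs
      linarith
    have haeq : a * (u ⬝ᵥ z - u ⬝ᵥ v) = w ⬝ᵥ z - w ⬝ᵥ v := div_mul_cancel₀ _ hden.ne'
    set w' := w - a • u with hw'def
    have hexp : ∀ y, w' ⬝ᵥ y = w ⬝ᵥ y - a * u ⬝ᵥ y := fun y => by
      rw [hw'def, sub_dotProduct, smul_dotProduct, smul_eq_mul]
    have hvz : w' ⬝ᵥ v = w' ⬝ᵥ z := by
      rw [hexp, hexp]
      linarith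
    have hgz' : w' ⬝ᵥ g = w' ⬝ᵥ z := by
      rw [hgdef, dotProduct_combo, hvz, ← add_mul, hst, one_mul]
    -- From y one reaches the hyperplane by moving towards z if y lies below it and towards v if
    -- above. As w' agrees at v and z, comparing q with g compares y with z.
    have hcross : ∀ y, ∃ q, u ⬝ᵥ q = c ∧ ∃ s t : ℝ, 0 < s ∧ 0 ≤ t ∧ s + t = 1 ∧
        (q = s • y + t • v ∨ q = s • y + t • z) := by
      intro y
      rcases lt_trichotomy (u ⬝ᵥ y) c with hy | hy | hy
      · obtain ⟨s, t, hs, ht, hst, hq⟩ := exists_combo_dotProduct_eq hy hzc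
        exact ⟨_, hq, s, t, hs, ht.le, hst, Or.inr rfl⟩
      · exact ⟨y, hy, 1, 0, one_pos, le_rfl, by norm_num, Or.inl (by simp)⟩
      · obtain ⟨s, t, hs, ht, hst, hq⟩ := exists_combo_dotProduct_eq hvc hy
        exact ⟨_, hq, t, s, ht, hs.le, by linarith, Or.inl (add_comm _ _)⟩
    have hval : ∀ y q, ∀ s t : ℝ, (q = s • y + t • v ∨ q = s • y + t • z) →
        w' ⬝ᵥ q = s * w' ⬝ᵥ y + t * w' ⬝ᵥ z := by
      rintro y q s t (rfl | rfl)
      · rw [dotProduct_combo, hvz]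
      · rw [dotProduct_combo]
    have hlow : ∀ y ∈ P, w' ⬝ᵥ z ≤ w' ⬝ᵥ y := by
      intro y hy
      obtain ⟨q, hq, s, t, hs, ht, hst, hqeq⟩ := hcross y
      have hqP : q ∈ P := by
        rcases hqeq with rfl | rfl
        · exact hP hy (hFP hv) hs.le ht hst
        · exact hP hy (hFP hz) hs.le ht hst
      have h1 := hw g ⟨hgF, hg⟩ q ⟨hqP, hq.ge⟩
      have h2 := hval y q s t hqeq
      have h3 := hexp q
      have h4 := hexp g
      rw [hq] at h3
      rw [hg] at h4
      have ht' : t = 1 - s := by linarith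
      subst ht'
      have : s * w' ⬝ᵥ z ≤ s * w' ⬝ᵥ y := by linarith
      exact le_of_mul_le_mul_left this hs
    have hupp : ∀ y ∈ F, w' ⬝ᵥ y ≤ w' ⬝ᵥ z := by
      intro y hy
      obtain ⟨q, hq, s, t, hs, ht, hst, hqeq⟩ := hcross y
      have hqF : q ∈ F := by
        rcases hqeq with rfl | rfl
        · exact hF hy hv hs.le ht hst
        · exact hF hy hz hs.le ht hst
      have h1 := hw q ⟨hqF, hq⟩ g ⟨hFP hgF, hg.ge⟩
      have h2 := hval y q s t hqeq
      have h3 := hexp q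
      have h4 := hexp g
      rw [hq] at h3
      rw [hg] at h4
      have ht' : t = 1 - s := by linarith
      subst ht'
      have : s * w' ⬝ᵥ y ≤ s * w' ⬝ᵥ z := by linarith
      exact le_of_mul_le_mul_left this hs
    exact ⟨a, ha, w', fun x hx y hy => (hupp x hx).trans (hlow y hy), by rw [hw'def]; abel⟩
  · rintro ⟨a, ha, w', hw', rfl⟩ x ⟨hx, hxc⟩ y ⟨hy, hyc⟩
    rw [add_dotProduct, add_dotProduct, smul_dotProduct, smul_dotProduct, hxc]
    exact add_le_add (mul_le_mul_of_nonneg_left hyc ha) (hw' x hx y hy)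

theorem CutsOff.isFace_truncation {n : ℕ} {P F : Set (Fin n → ℝ)} {v u : Fin n → ℝ} {c : ℝ}
    (hc : CutsOff P v u c) (h : IsPolytope P) (hF : IsFace P F) (hne : F ≠ {v}) :
    IsFace (truncation P u c) (truncation F u c) ∧
      normalCone (truncation P u c) (truncation F u c) = normalCone P F := by
  have hz := hc.exists_lt_of_ne h hF hne
  refine ⟨?_, normalCone_truncation h.convex (h.face_convex hF) hF.subset hz⟩
  obtain ⟨w, _, rfl⟩ := hF.exists_mem_normalCone
  obtain ⟨z, hzF, hzc⟩ := hz
  exact isFace_iff.2 ⟨⟨z, hzF, hzc.le⟩, w, (minFace_truncation ⟨z, hzF, hzc⟩).symm⟩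

theorem CutsOff.isFace_slice {n : ℕ} {P F : Set (Fin n → ℝ)} {v u : Fin n → ℝ} {c : ℝ}
    (hc : CutsOff P v u c) (h : IsPolytope P) (hF : IsFace P F) (hvF : v ∈ F) (hne : F ≠ {v}) :
    IsFace (truncation P u c) {x ∈ F | u ⬝ᵥ x = c} ∧
      normalCone (truncation P u c) {x ∈ F | u ⬝ᵥ x = c} =
        PointedCone.hull ℝ {u} ⊔ normalCone P F := by
  have hz := hc.exists_lt_of_ne h hF hne
  refine ⟨?_, normalCone_truncation_slice h.convex (h.face_convex hF) hF.subset hc.lt hvF hz⟩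
  obtain ⟨w, _, rfl⟩ := hF.exists_mem_normalCone
  obtain ⟨h1, h2⟩ := minFace_smul_add_truncation h.convex one_pos hc.lt hvF hz
  exact isFace_iff.2 ⟨h2, _, h1.symm⟩

/-- The faces of a truncation at `v` are the truncations of the faces other than `v` and the
slices of the faces through `v`. -/
theorem CutsOff.exists_of_isFace {n : ℕ} {P G : Set (Fin n → ℝ)} {v u : Fin n → ℝ} {c : ℝ}
    (hc : CutsOff P v u c) (h : IsPolytope P) (hG : IsFace (truncation P u c) G) :
    ∃ F, IsFace P F ∧ F ≠ {v} ∧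
      (G = truncation F u c ∨ v ∈ F ∧ G = {x ∈ F | u ⬝ᵥ x = c}) := by
  obtain ⟨w, _, hGw⟩ := hG.exists_mem_normalCone
  have hvP := hc.isVertex.mem
  have hface : ∀ w', IsFace P (minFace P w') := fun w' =>
    isFace_minFace (h.minFace_nonempty ⟨v, hvP⟩ w')
  by_cases hvw : v ∈ minFace P w
  swap
  · have hne : minFace P w ≠ {v} := fun heq => hvw (heq ▸ rfl)
    refine ⟨_, hface w, hne, Or.inl ?_⟩
    rw [hGw, minFace_truncation (hc.exists_lt_of_ne h (hface w) hne)]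
  obtain ⟨p, hp⟩ := hG.2
  have hpQ := hG.subset hp
  set V : Set (Fin n → ℝ) := {z | IsVertex P z ∧ z ≠ v} with hVdef
  have hVfin : V.Finite := h.finite_vertices.subset fun z hz => hz.1
  have hVne : V.Nonempty := by
    by_contra hemp
    rw [Set.not_nonempty_iff_eq_empty] at hemp
    have hsub : P ⊆ {v} := by
      rw [h.eq_convexHull]
      refine convexHull_min (fun z hz => ?_) (convex_singleton v)
      by_contra hzv
      have : z ∈ V := ⟨hz, hzv⟩
      rw [hemp] at this
      exact this
    have hpv : p = v := hsub hpQ.1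
    have := hpQ.2
    rw [hpv] at this
    exact absurd hc.lt (not_lt.2 this)
  have hpos : ∀ z ∈ V, 0 < u ⬝ᵥ z - u ⬝ᵥ v := fun z hz => by
    have := hc.lt_of_ne z hz.1 hz.2
    have := hc.lt
    linarith
  -- The least slope of w relative to u is the largest multiple of u that can be subtracted while v
  -- stays minimal; at that point z₀ becomes minimal too.
  obtain ⟨z₀, hz₀, hmin⟩ := Set.exists_min_image V
    (fun z => (w ⬝ᵥ z - w ⬝ᵥ v) / (u ⬝ᵥ z - u ⬝ᵥ v)) hVfin hVne
  set a := (w ⬝ᵥ z₀ - w ⬝ᵥ v) / (u ⬝ᵥ z₀ - u ⬝ᵥ v) with hadef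
  have ha : 0 ≤ a := div_nonneg (sub_nonneg.2 (hvw.2 z₀ hz₀.1.mem)) (hpos z₀ hz₀).le
  have haeq : a * (u ⬝ᵥ z₀ - u ⬝ᵥ v) = w ⬝ᵥ z₀ - w ⬝ᵥ v := div_mul_cancel₀ _ (hpos z₀ hz₀).ne'
  set w' := w - a • u with hw'def
  have hexp : ∀ y, w' ⬝ᵥ y = w ⬝ᵥ y - a * u ⬝ᵥ y := fun y => by
    rw [hw'def, sub_dotProduct, smul_dotProduct, smul_eq_mul]
  have hle : ∀ y ∈ P, w' ⬝ᵥ v ≤ w' ⬝ᵥ y := by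
    intro y hy
    rw [h.eq_convexHull] at hy
    refine le_dotProduct_of_mem_convexHull (fun z hz => ?_) hy
    by_cases hzv : z = v
    · rw [hzv]
    · have h1 := hmin z ⟨hz, hzv⟩
      rw [le_div_iff₀ (hpos z ⟨hz, hzv⟩)] at h1
      rw [hexp, hexp]
      linarith
  have hvw' : v ∈ minFace P w' := ⟨hvP, hle⟩
  have hz₀w' : z₀ ∈ minFace P w' := by
    refine ⟨hz₀.1.mem, fun y hy => ?_⟩
    have : w' ⬝ᵥ z₀ = w' ⬝ᵥ v := by
      rw [hexp, hexp]
      linarith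
    rw [this]
    exact hle y hy
  have hne : minFace P w' ≠ {v} := fun heq => by
    rw [heq] at hz₀w'
    exact hz₀.2 hz₀w'
  have hz := hc.exists_lt_of_ne h (hface w') hne
  refine ⟨_, hface w', hne, ?_⟩
  -- With a = 0 no tilting was needed and the face is a truncated one; with a > 0 the term a•u
  -- forces minimizers onto the hyperplane.
  rcases ha.eq_or_lt with ha0 | ha0
  · left
    have : w' = w := by rw [hw'def, ← ha0, zero_smul, sub_zero]
    rw [hGw, ← this, minFace_truncation hz]
  · right
    refine ⟨hvw', ?_⟩
    have : w = a • u + w' := by rw [hw'def]; abel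
    rw [hGw, this, (minFace_smul_add_truncation h.convex ha0 hc.lt hvw' hz).1]

/-- The normal fan of a truncation at a vertex is a star subdivision at its normal cone. -/
theorem CutsOff.normalFan_truncation {n : ℕ} {P : Set (Fin n → ℝ)} {v u : Fin n → ℝ} {c : ℝ}
    (hc : CutsOff P v u c) (h : IsPolytope P) :
    normalFan (truncation P u c) = starSubdivision (normalFan P) (normalCone P {v}) u := by
  have hv := hc.isVertex
  have hne_iff : ∀ F, IsFace P F → (normalCone P F ≠ normalCone P {v} ↔ F ≠ {v}) := fun F hF =>
    not_congr ⟨fun heq => normalCone_injOn hF hv heq, fun heq => by rw [heq]⟩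
  ext σ
  rw [mem_starSubdivision_iff (maximal_normalCone_vertex hv)]
  constructor
  · rintro ⟨G, hG, rfl⟩
    obtain ⟨F, hF, hne, rfl | ⟨hvF, rfl⟩⟩ := hc.exists_of_isFace h hG
    · left
      rw [(hc.isFace_truncation h hF hne).2]
      exact ⟨⟨F, hF, rfl⟩, (hne_iff F hF).2 hne⟩
    · right
      rw [(hc.isFace_slice h hF hvF hne).2]
      exact ⟨_, ⟨F, hF, rfl⟩, normalCone_anti (Set.singleton_subset_iff.2 hvF),
        (hne_iff F hF).2 hne, rfl⟩
  · rintro (⟨⟨F, hF, rfl⟩, hne⟩ | ⟨_, ⟨F, hF, rfl⟩, hle, hne, rfl⟩)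
    · have := hc.isFace_truncation h hF ((hne_iff F hF).1 hne)
      exact ⟨_, this.1, this.2.symm⟩
    · have hvF : v ∈ F := (normalCone_le_iff hF hv).1 hle rfl
      have := hc.isFace_slice h hF hvF ((hne_iff F hF).1 hne)
      exact ⟨_, this.1, this.2.symm⟩

/-- The other vertices are finite in number and have strictly larger values than v, so a level fits
in between. -/
theorem IsPolytope.exists_cutsOff {n : ℕ} {P : Set (Fin n → ℝ)} (h : IsPolytope P)
    {v u : Fin n → ℝ} (hv : IsVertex P v) (hu : minFace P u = {v}) : ∃ c, CutsOff P v u c := by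
  have hvu : v ∈ minFace P u := by rw [hu]; rfl
  have hlt : ∀ z, IsVertex P z → z ≠ v → u ⬝ᵥ v < u ⬝ᵥ z := by
    intro z hz hzv
    refine lt_of_le_of_ne (hvu.2 z hz.mem) fun heq => hzv ?_
    have : z ∈ minFace P u := ⟨hz.mem, fun y hy => heq ▸ hvu.2 y hy⟩
    rw [hu] at this
    exact this
  set V : Set (Fin n → ℝ) := {z | IsVertex P z ∧ z ≠ v} with hVdef
  have hVfin : V.Finite := h.finite_vertices.subset fun z hz => hz.1
  rcases V.eq_empty_or_nonempty with hemp | hVne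
  · refine ⟨u ⬝ᵥ v + 1, hv, by linarith, fun z hz hzv => ?_⟩
    have : z ∈ V := ⟨hz, hzv⟩
    rw [hemp] at this
    exact this.elim
  · obtain ⟨z₀, hz₀, hmin⟩ := Set.exists_min_image V (fun z => u ⬝ᵥ z) hVfin hVne
    have h0 := hlt z₀ hz₀.1 hz₀.2
    refine ⟨(u ⬝ᵥ v + u ⬝ᵥ z₀) / 2, hv, by linarith, fun z hz hzv => ?_⟩
    have := hmin z ⟨hz, hzv⟩
    linarith

/-! ### A truncation is a polytope of full dimension. -/

/-- The truncation is generated by the other vertices and their central projections from v to the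
hyperplane: a point on a segment from v to y in the hull of the other vertices is kept exactly when
it lies between the projection of y and y. -/
theorem CutsOff.isPolytope_truncation {n : ℕ} {P : Set (Fin n → ℝ)} {v u : Fin n → ℝ} {c : ℝ}
    (hc : CutsOff P v u c) (h : IsPolytope P) : IsPolytope (truncation P u c) := by
  classical
  set V : Set (Fin n → ℝ) := {z | IsVertex P z ∧ z ≠ v} with hVdef
  have hVfin : V.Finite := h.finite_vertices.subset fun z hz => hz.1
  have hvP := hc.isVertex.mem
  -- central projection from `v` to the hyperplane `⟨u, ·⟩ = c`
  set r : (Fin n → ℝ) → ℝ := fun z => (u ⬝ᵥ z - u ⬝ᵥ v) / (c - u ⬝ᵥ v) with hrdef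
  set π : (Fin n → ℝ) → (Fin n → ℝ) := fun z => v + (r z)⁻¹ • (z - v) with hπdef
  have hcv : 0 < c - u ⬝ᵥ v := by have := hc.lt; linarith
  have hr : ∀ z, c < u ⬝ᵥ z → 1 < r z := fun z hz => by
    rw [hrdef, lt_div_iff₀ hcv]
    linarith
  have hπc : ∀ z, c < u ⬝ᵥ z → u ⬝ᵥ π z = c := fun z hz => by
    have h1 := hr z hz
    have h2 : r z * (c - u ⬝ᵥ v) = u ⬝ᵥ z - u ⬝ᵥ v := div_mul_cancel₀ _ hcv.ne'
    have h3 : r z ≠ 0 := by linarith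
    rw [hπdef]
    simp only
    rw [dotProduct_add, dotProduct_smul, dotProduct_sub, smul_eq_mul, ← h2]
    field_simp
    ring
  have hπeq : ∀ z, π z = (1 - (r z)⁻¹) • v + (r z)⁻¹ • z := fun z => by
    rw [hπdef]
    simp only [smul_sub, sub_smul, one_smul]
    abel
  have hπseg : ∀ z, c < u ⬝ᵥ z → 0 < (r z)⁻¹ ∧ (r z)⁻¹ ≤ 1 := fun z hz =>
    ⟨inv_pos.2 (by linarith [hr z hz]), inv_le_one_of_one_le₀ (hr z hz).le⟩
  refine ⟨hVfin.toFinset ∪ hVfin.toFinset.image π, ?_⟩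
  rw [Finset.coe_union, Finset.coe_image, hVfin.coe_toFinset]
  have hVc : ∀ z ∈ V, c < u ⬝ᵥ z := fun z hz => hc.lt_of_ne z hz.1 hz.2
  apply Set.Subset.antisymm
  · rintro x ⟨hxP, hxc⟩
    rw [h.eq_convexHull] at hxP
    have hins : {z | IsVertex P z} = insert v V := by
      ext z
      simp only [Set.mem_insert_iff, hVdef, Set.mem_ofPred_eq]
      by_cases hzv : z = v
      · simp [hzv, hc.isVertex]
      · simp [hzv]
    have hVne : V.Nonempty := by
      by_contra hemp
      rw [Set.not_nonempty_iff_eq_empty] at hemp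
      rw [hins, hemp] at hxP
      simp only [insert_empty_eq, convexHull_singleton, Set.mem_singleton_iff] at hxP
      rw [hxP] at hxc
      linarith
    rw [hins, convexHull_insert hVne, convexJoin_singleton_left] at hxP
    simp only [Set.mem_iUnion] at hxP
    obtain ⟨y, hy, a, b, ha, hb, hab, rfl⟩ := hxP
    have hproj : convexHull ℝ V ⊆ {z | c < u ⬝ᵥ z ∧ π z ∈ convexHull ℝ (π '' V)} := by
      refine convexHull_min (fun z hz => ⟨hVc z hz,
        subset_convexHull ℝ _ (Set.mem_image_of_mem π hz)⟩) ?_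
      rintro z ⟨hz, hπz⟩ z' ⟨hz', hπz'⟩ s t hs ht hst
      have hcomb : c < u ⬝ᵥ (s • z + t • z') := convex_lt_dotProduct u c hz hz' hs ht hst
      refine ⟨hcomb, ?_⟩
      have hr1 := hr z hz
      have hr2 := hr z' hz'
      have hr3 := hr _ hcomb
      have hradd : r (s • z + t • z') = s * r z + t * r z' := by
        simp only [hrdef]
        rw [dotProduct_combo]
        have hs' : s = 1 - t := by linarith
        subst hs'
        field_simp
        ring
      have hpos : 0 < s * r z + t * r z' := by rw [← hradd]; linarith
      -- Central projection preserves convex combinations up to reweighting: since r is affine, the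
      -- new weights are proportional to s·r(z) and t·r(z').
      have hmem := convex_convexHull ℝ (π '' V) hπz hπz'
        (a := s * r z / (s * r z + t * r z')) (b := t * r z' / (s * r z + t * r z'))
        (div_nonneg (mul_nonneg hs (by linarith)) hpos.le)
        (div_nonneg (mul_nonneg ht (by linarith)) hpos.le)
        (by rw [← add_div, div_self hpos.ne'])
      convert hmem using 1
      have h1 : r z ≠ 0 := by linarith
      have h2 : r z' ≠ 0 := by linarith
      ext i
      simp only [hπdef, hradd, Pi.add_apply, Pi.smul_apply, Pi.sub_apply, smul_eq_mul]
      have hs' : s = 1 - t := by linarith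
      subst hs'
      field_simp
      ring
    have hyc := (hproj hy).1
    obtain ⟨hr0, hr1⟩ := hπseg y hyc
    have hπy : π y ∈ convexHull ℝ (V ∪ π '' V) :=
      convexHull_mono Set.subset_union_right (hproj hy).2
    have hy' : y ∈ convexHull ℝ (V ∪ π '' V) := convexHull_mono Set.subset_union_left hy
    -- write the point as a combination of `π y` and `y`
    have h1 := hπc y hyc
    rw [hπeq, dotProduct_combo] at h1
    rw [dotProduct_combo] at hxc
    have hρ : (r y)⁻¹ ≤ b := by
      have ha' : a = 1 - b := by linarith
      subst ha'
      by_contra hlt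
      rw [not_le] at hlt
      have hyv : 0 < u ⬝ᵥ y - u ⬝ᵥ v := by linarith
      nlinarith
    rcases eq_or_lt_of_le hr1 with h1' | h1'
    · have hb1 : b = 1 := by linarith
      have ha0 : a = 0 := by linarith
      rw [hb1, ha0, zero_smul, one_smul, zero_add]
      exact hy'
    · have hden : 0 < 1 - (r y)⁻¹ := by linarith
      have hcomb : a • v + b • y =
          (a / (1 - (r y)⁻¹)) • π y + (1 - a / (1 - (r y)⁻¹)) • y := by
        have ha' : b = 1 - a := by linarith
        subst ha'
        rw [hπeq]
        ext i
        simp only [Pi.add_apply, Pi.smul_apply, smul_eq_mul]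
        generalize (r y)⁻¹ = ρ at hden
        field_simp
        ring
      rw [hcomb]
      refine convex_convexHull ℝ _ hπy hy' (div_nonneg ha hden.le) ?_ (by ring)
      rw [sub_nonneg, div_le_one hden]
      linarith
  · have hconv : Convex ℝ (truncation P u c) := h.convex.inter (convex_le_dotProduct u c)
    refine convexHull_min ?_ hconv
    rintro z (hz | ⟨z, hz, rfl⟩)
    · exact ⟨hz.1.mem, (hVc z hz).le⟩
    · refine ⟨?_, (hπc z (hVc z hz)).ge⟩
      rw [hπeq]
      obtain ⟨h0, h1⟩ := hπseg z (hVc z hz)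
      exact h.convex hvP hz.1.mem (by linarith) h0.le (by ring)

/-- Some vertex lies strictly inside the half-space, and interior points of P near it are interior
to the truncation. Positive dimension is needed to exclude P = {v}. -/
theorem CutsOff.isFullPolytope_truncation {n : ℕ} [NeZero n] {P : Set (Fin n → ℝ)}
    {v u : Fin n → ℝ} {c : ℝ} (hc : CutsOff P v u c) (h : IsFullPolytope P) :
    IsFullPolytope (truncation P u c) := by
  have hP : IsPolytope P := h.1
  refine ⟨hc.isPolytope_truncation hP, ?_⟩
  have hint : (interior P).Nonempty := (hP.convex.interior_nonempty_iff_affineSpan_eq_top).2 h.2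
  have hPface : IsFace P P := ⟨IsExposed.refl P, ⟨v, hc.isVertex.mem⟩⟩
  have hne : P ≠ {v} := by
    intro heq
    rw [heq, interior_singleton] at hint
    exact hint.ne_empty rfl
  obtain ⟨z, hz, hzc⟩ := hc.exists_lt_of_ne hP hPface hne
  have hzcl : z ∈ closure (interior P) := by
    rw [hP.convex.closure_interior_eq_closure_of_nonempty_interior hint]
    exact subset_closure hz
  have hopen : IsOpen {x : Fin n → ℝ | c < u ⬝ᵥ x} :=
    isOpen_lt continuous_const (continuous_dotProduct_left u)
  obtain ⟨y, hyc, hy⟩ := mem_closure_iff.1 hzcl _ hopen hzc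
  have hconv : Convex ℝ (truncation P u c) := hP.convex.inter (convex_le_dotProduct u c)
  rw [← hconv.interior_nonempty_iff_affineSpan_eq_top]
  refine ⟨y, mem_interior.2 ⟨{x | c < u ⬝ᵥ x} ∩ interior P, ?_,
    hopen.inter isOpen_interior, hyc, hy⟩⟩
  rintro x ⟨hx1, hx2⟩
  exact ⟨interior_subset hx2, le_of_lt hx1⟩

/-! ### Adding a ray to a cone, and the edges at a vertex. -/

theorem span_hull_singleton_sup {n : ℕ} {φ : PointedCone ℝ (Fin n → ℝ)} {x : Fin n → ℝ} :
    Submodule.span ℝ ((PointedCone.hull ℝ {x} ⊔ φ : PointedCone ℝ (Fin n → ℝ)) :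
      Set (Fin n → ℝ)) =
      Submodule.span ℝ {x} ⊔ Submodule.span ℝ (φ : Set (Fin n → ℝ)) := by
  apply le_antisymm
  · rw [Submodule.span_le]
    intro y hy
    obtain ⟨a, _, w, hw, rfl⟩ := mem_hull_singleton_sup.1 hy
    exact Submodule.add_mem_sup
      (Submodule.smul_mem _ a (Submodule.mem_span_singleton_self x)) (Submodule.subset_span hw)
  · refine sup_le (Submodule.span_mono ?_) (Submodule.span_mono ?_)
    · rintro _ rfl
      exact mem_hull_singleton_sup.2 ⟨1, zero_le_one, 0, φ.zero_mem, by simp⟩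
    · intro w hw
      exact mem_hull_singleton_sup.2 ⟨0, le_rfl, w, hw, by simp⟩

theorem coneDim_hull_singleton_sup {n : ℕ} {φ : PointedCone ℝ (Fin n → ℝ)} {x : Fin n → ℝ}
    (hx : x ∉ Submodule.span ℝ (φ : Set (Fin n → ℝ))) :
    coneDim (PointedCone.hull ℝ {x} ⊔ φ) = coneDim φ + 1 := by
  have hx0 : x ≠ 0 := fun h => hx (h ▸ Submodule.zero_mem _)
  have hdisj : Disjoint (Submodule.span ℝ {x}) (Submodule.span ℝ (φ : Set (Fin n → ℝ))) :=
    (Submodule.disjoint_span_singleton' hx0).2 hx |>.symm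
  have := Submodule.finrank_sup_add_finrank_inf_eq (Submodule.span ℝ {x})
    (Submodule.span ℝ (φ : Set (Fin n → ℝ)))
  rw [hdisj.eq_bot, finrank_bot, finrank_span_singleton hx0] at this
  rw [coneDim, coneDim, span_hull_singleton_sup]
  omega

theorem faceDim_singleton {n : ℕ} (v : Fin n → ℝ) : faceDim {v} = 0 := by
  rw [faceDim, vectorSpan_singleton, finrank_bot]

/-- A functional that does not decrease from the vertex `v` along any edge is minimal at `v`. -/
theorem IsPolytope.mem_normalCone_of_edges {n : ℕ} {P : Set (Fin n → ℝ)} (h : IsPolytope P)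
    {v w : Fin n → ℝ} (hv : IsVertex P v)
    (hw : ∀ E, IsEdge P E → v ∈ E → ∀ y ∈ E, w ⬝ᵥ v ≤ w ⬝ᵥ y) : w ∈ normalCone P {v} := by
  obtain ⟨u, _, hu⟩ := hv.exists_mem_normalCone
  obtain ⟨c, hc⟩ := h.exists_cutsOff hv hu.symm
  have hQ : IsPolytope (truncation P u c) := hc.isPolytope_truncation h
  have hPface : IsFace P P := ⟨IsExposed.refl P, ⟨v, hv.mem⟩⟩
  -- It suffices to compare v with the slice of a hyperplane cutting off v. There w is minimal at
  -- some vertex g of the truncation, and g turns out to lie on an edge through v.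
  have hle : ∀ y ∈ P, u ⬝ᵥ y = c → w ⬝ᵥ v ≤ w ⬝ᵥ y := by
    by_cases hne : P = {v}
    · intro y hy _
      rw [hne] at hy
      rw [hy]
    intro y hy hyc
    have hK := (hc.isFace_slice h hPface hv.mem hne).1
    set K : Set (Fin n → ℝ) := {x ∈ P | u ⬝ᵥ x = c} with hKdef
    have hKc : IsCompact K := hQ.face_isCompact hK
    obtain ⟨p, hp, hpmin⟩ :=
      hKc.exists_isMinOn hK.2 (continuous_dotProduct_left w).continuousOn
    have hM : IsFace K (minFace K w) := isFace_minFace ⟨p, hp, fun y hy => hpmin hy⟩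
    obtain ⟨g, hg⟩ := (hM.1.isCompact hKc).extremePoints_nonempty hM.2
    have hgQ : IsVertex (truncation P u c) g := hQ.isVertex_of_mem_extremePoints
      ((hK.1.isExtreme.trans hM.1.isExtreme).extremePoints_subset_extremePoints hg)
    obtain ⟨F, hF, hFne, hgF | ⟨hvF, hgF⟩⟩ := hc.exists_of_isFace h hgQ
    · obtain ⟨z, hz, hzc⟩ := hc.exists_lt_of_ne h hF hFne
      have : z ∈ truncation F u c := ⟨hz, hzc.le⟩
      rw [← hgF] at this
      have hzg : z = g := this
      rw [hzg] at hzc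
      exact absurd hg.1.1.2 hzc.ne'
    -- The ray through u raises the dimension of the normal cone by one, so the vertex g is the
    -- slice of a one-dimensional face.
    · have hdim : coneDim (PointedCone.hull ℝ {u} ⊔ normalCone P F) =
          coneDim (normalCone P F) + 1 := by
        refine coneDim_hull_singleton_sup fun hmem => ?_
        obtain ⟨z, hz, hzc⟩ := hc.exists_lt_of_ne h hF hFne
        have := (h.mem_span_normalCone hF).1 hmem v hvF z hz
        have := hc.lt
        linarith
      have h1 := hQ.coneDim_normalCone hgQ
      have h2 := (hc.isFace_slice h hF hvF hFne).2
      have h3 := h.coneDim_normalCone hF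
      rw [← hgF] at h2
      rw [h2, hdim, faceDim_singleton] at h1
      have hedge : IsEdge P F := ⟨hF, by omega⟩
      have hgmem : g ∈ F := by
        have : g ∈ ({g} : Set (Fin n → ℝ)) := rfl
        rw [hgF] at this
        exact this.1
      exact (hw F hedge hvF g hgmem).trans (hg.1.2 y ⟨hy, hyc⟩)
  intro x hx y hy
  obtain rfl : x = v := hx
  rw [h.eq_convexHull] at hy
  refine le_dotProduct_of_mem_convexHull (fun z hz => ?_) hy
  by_cases hzv : z = x
  · rw [hzv]
  obtain ⟨s, t, hs, ht, hst, hq⟩ := exists_combo_dotProduct_eq hc.lt (hc.lt_of_ne z hz hzv)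
  have := hle _ (h.convex hv.mem hz.mem hs.le ht.le hst) hq
  rw [dotProduct_combo] at this
  have hs' : s = 1 - t := by linarith
  subst hs'
  exact le_of_mul_le_mul_left (by linarith) ht

/-! ### Orthant coordinates at a vertex of a smooth polytope. -/

/-- The face of the nonnegative orthant with support `A`, in linear coordinates `e`. -/
def orthantFace {n : ℕ} (e : (Fin n → ℝ) ≃ₗ[ℝ] (Fin n → ℝ)) (A : Finset (Fin n)) :
    PointedCone ℝ (Fin n → ℝ) where
  carrier := {w | ∀ i, 0 ≤ e w i ∧ (i ∉ A → e w i = 0)}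
  zero_mem' := fun i => by simp
  add_mem' := by
    intro a b ha hb i
    rw [map_add, Pi.add_apply]
    exact ⟨add_nonneg (ha i).1 (hb i).1, fun hi => by rw [(ha i).2 hi, (hb i).2 hi, add_zero]⟩
  smul_mem' := by
    intro c a ha i
    have h : (c • a : Fin n → ℝ) = (c : ℝ) • a := rfl
    rw [h, map_smul, Pi.smul_apply, smul_eq_mul]
    exact ⟨mul_nonneg c.2 (ha i).1, fun hi => by rw [(ha i).2 hi, mul_zero]⟩

theorem mem_orthantFace {n : ℕ} {e : (Fin n → ℝ) ≃ₗ[ℝ] (Fin n → ℝ)} {A : Finset (Fin n)}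
    {w : Fin n → ℝ} : w ∈ orthantFace e A ↔ ∀ i, 0 ≤ e w i ∧ (i ∉ A → e w i = 0) := Iff.rfl

theorem symm_single_mem_orthantFace {n : ℕ} {e : (Fin n → ℝ) ≃ₗ[ℝ] (Fin n → ℝ)}
    {A : Finset (Fin n)} {i : Fin n} (hi : i ∈ A) :
    e.symm (Pi.single i 1) ∈ orthantFace e A := by
  intro j
  rw [LinearEquiv.apply_symm_apply, Pi.single_apply]
  by_cases hji : j = i
  · simp [hji, hi]
  · simp [hji]

theorem orthantFace_le_iff {n : ℕ} {e : (Fin n → ℝ) ≃ₗ[ℝ] (Fin n → ℝ)} {A B : Finset (Fin n)} :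
    orthantFace e A ≤ orthantFace e B ↔ A ⊆ B := by
  constructor
  · intro hle i hi
    by_contra hiB
    have := (hle (symm_single_mem_orthantFace (e := e) hi) i).2 hiB
    simp at this
  · exact fun hAB w hw i => ⟨(hw i).1, fun hi => (hw i).2 fun hiA => hi (hAB hiA)⟩

theorem orthantFace_injective {n : ℕ} (e : (Fin n → ℝ) ≃ₗ[ℝ] (Fin n → ℝ)) :
    Function.Injective (orthantFace e) := fun _ _ h =>
  Finset.Subset.antisymm (orthantFace_le_iff.1 h.le) (orthantFace_le_iff.1 h.ge)

theorem apply_eq_zero_of_mem_span_orthantFace {n : ℕ} {e : (Fin n → ℝ) ≃ₗ[ℝ] (Fin n → ℝ)}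
    {A : Finset (Fin n)} {w : Fin n → ℝ}
    (hw : w ∈ Submodule.span ℝ (orthantFace e A : Set (Fin n → ℝ))) {i : Fin n} (hi : i ∉ A) :
    e w i = 0 := by
  induction hw using Submodule.span_induction with
  | mem w hw => exact (hw i).2 hi
  | zero => simp
  | add a b _ _ ha hb => rw [map_add, Pi.add_apply, ha, hb, add_zero]
  | smul c a _ ha => rw [map_smul, Pi.smul_apply, ha, smul_zero]

theorem coneDim_orthantFace {n : ℕ} (e : (Fin n → ℝ) ≃ₗ[ℝ] (Fin n → ℝ)) (A : Finset (Fin n)) :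
    coneDim (orthantFace e A) = A.card := by
  have hli : LinearIndependent ℝ (fun i : Fin n => e.symm (Pi.single i (1 : ℝ))) := by
    have := ((Pi.basisFun ℝ (Fin n)).map e.symm).linearIndependent
    convert this using 1
    ext1 i
    rw [Module.Basis.map_apply, Pi.basisFun_apply]
  have hliA : LinearIndependent ℝ (fun i : A => e.symm (Pi.single (i : Fin n) (1 : ℝ))) :=
    hli.comp _ Subtype.val_injective
  have hspan : Submodule.span ℝ (orthantFace e A : Set (Fin n → ℝ)) =
      Submodule.span ℝ (Set.range fun i : A => e.symm (Pi.single (i : Fin n) (1 : ℝ))) := by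
    apply le_antisymm
    · rw [Submodule.span_le]
      intro w hw
      have hsum : w = ∑ i, e w i • e.symm (Pi.single i (1 : ℝ)) := by
        apply e.injective
        rw [map_sum]
        simp only [map_smul, LinearEquiv.apply_symm_apply]
        exact pi_eq_sum_univ' (e w)
      rw [hsum]
      refine Submodule.sum_mem _ fun i _ => ?_
      by_cases hi : i ∈ A
      · exact Submodule.smul_mem _ _ (Submodule.subset_span ⟨⟨i, hi⟩, rfl⟩)
      · rw [(hw i).2 hi, zero_smul]
        exact Submodule.zero_mem _
    · refine Submodule.span_mono ?_
      rintro _ ⟨i, rfl⟩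
      exact symm_single_mem_orthantFace i.2
  rw [coneDim, hspan, finrank_span_eq_card hliA, Fintype.card_coe]

/-- At each vertex of a smooth polytope the cones of the normal fan are, in suitable linear
coordinates, the faces of the nonnegative orthant. -/
theorem IsSmoothPolytope.exists_orthantFace {n : ℕ} {P : Set (Fin n → ℝ)}
    (hP : IsSmoothPolytope P) (h : IsPolytope P) {v : Fin n → ℝ} (hv : IsVertex P v) :
    ∃ e : (Fin n → ℝ) ≃ₗ[ℝ] (Fin n → ℝ),
      {σ | σ ∈ normalFan P ∧ σ ≤ normalCone P {v}} = Set.range (orthantFace e) := by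
  obtain ⟨b, hb⟩ := hP.2.2 v hv
  have hbedge : ∀ i, ∃ t : ℝ, 0 < t ∧
      IsEdge P (segment ℝ v (v + t • (fun j => (b i j : ℝ)))) := fun i => by
    have : b i ∈ edgeVectors P v := hb ▸ Set.mem_range_self i
    exact this.2
  choose t ht hE using hbedge
  set β : Fin n → (Fin n → ℝ) := fun i j => (b i j : ℝ) with hβdef
  -- The coordinates are the pairings with the edge vectors; an integral basis has unit determinant,
  -- so they are invertible over ℝ.
  obtain ⟨e, he⟩ : ∃ e : (Fin n → ℝ) ≃ₗ[ℝ] (Fin n → ℝ), ∀ w i, e w i = w ⬝ᵥ β i := by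
    have hdet : IsUnit (Matrix.of β).det := by
      have h1 := (Pi.basisFun ℤ (Fin n)).isUnit_det b
      rw [Module.Basis.det_apply] at h1
      have h2 : Matrix.of β = (((Pi.basisFun ℤ (Fin n)).toMatrix b).map
          (Int.castRingHom ℝ)).transpose := by
        ext i j
        simp [hβdef, Module.Basis.toMatrix_apply]
      rw [h2, Matrix.det_transpose, ← RingHom.mapMatrix_apply, ← RingHom.map_det]
      exact h1.map _
    refine ⟨Matrix.toLinearEquiv' (Matrix.of β) (Matrix.invertibleOfIsUnitDet _ hdet),
      fun w i => ?_⟩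
    exact dotProduct_comm (β i) w
  have hend : ∀ i, v + t i • β i ∈ P := fun i => (hE i).1.subset (right_mem_segment ℝ _ _)
  have hdot : ∀ w i, w ⬝ᵥ (v + t i • β i) = w ⬝ᵥ v + t i * e w i := fun w i => by
    rw [dotProduct_add, dotProduct_smul, smul_eq_mul, he]
  have hinj : Function.Injective fun i => segment ℝ v (v + t i • β i) := by
    intro i j hij
    by_contra hne
    have hmem : v + t i • β i ∈ segment ℝ v (v + t j • β j) := by
      have : segment ℝ v (v + t i • β i) = segment ℝ v (v + t j • β j) := hij
      rw [← this]
      exact right_mem_segment ℝ _ _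
    obtain ⟨a, c, _, _, hac, heq⟩ := hmem
    have h1 := hdot (e.symm (Pi.single i 1)) i
    rw [← heq, dotProduct_combo, hdot, LinearEquiv.apply_symm_apply, Pi.single_eq_same,
      Pi.single_eq_of_ne (Ne.symm hne)] at h1
    have ha : a = 1 - c := by linarith
    subst ha
    have := ht i
    linarith
  -- Simplicity allows only n edges at v, and the basis vectors already give n distinct ones.
  have hedges : Set.range (fun i => segment ℝ v (v + t i • β i)) = {E | IsEdge P E ∧ v ∈ E} := by
    apply Set.eq_of_subset_of_ncard_le
    · rintro _ ⟨i, rfl⟩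
      exact ⟨hE i, left_mem_segment ℝ _ _⟩
    · rw [hP.2.1 v hv, ← Set.image_univ, Set.ncard_image_of_injective _ hinj, Set.ncard_univ,
        Nat.card_fin]
    · exact h.finite_faces.subset fun E hE => hE.1.1
  have hcone : ∀ w, w ∈ normalCone P {v} ↔ ∀ i, 0 ≤ e w i := by
    intro w
    constructor
    · intro hw i
      have h1 := hw v rfl _ (hend i)
      rw [hdot] at h1
      have : 0 ≤ t i * e w i := by linarith
      exact nonneg_of_mul_nonneg_right this (ht i)
    · intro hw
      refine h.mem_normalCone_of_edges hv fun E hE hvE y hy => ?_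
      have : E ∈ {E | IsEdge P E ∧ v ∈ E} := ⟨hE, hvE⟩
      rw [← hedges] at this
      obtain ⟨i, rfl⟩ := this
      obtain ⟨a, c, _, hc, hac, rfl⟩ := hy
      rw [dotProduct_combo, hdot]
      have ha : a = 1 - c := by linarith
      subst ha
      have := mul_nonneg hc (mul_nonneg (ht i).le (hw i))
      linarith
  have hface : ∀ u ∈ normalCone P {v}, normalCone P (minFace P u) =
      orthantFace e (Finset.univ.filter fun i => 0 < e u i) := by
    intro u hu
    have hvF : v ∈ minFace P u := ⟨hv.mem, hu v rfl⟩
    have hu0 := (hcone u).1 hu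
    ext w
    rw [mem_orthantFace]
    constructor
    · intro hw i
      have hw0 := (hcone w).1 (normalCone_anti (Set.singleton_subset_iff.2 hvF) hw) i
      refine ⟨hw0, fun hi => ?_⟩
      rw [Finset.mem_filter_univ, not_lt] at hi
      have hui : e u i = 0 := le_antisymm hi (hu0 i)
      have hmem : v + t i • β i ∈ minFace P u := by
        refine ⟨hend i, fun y hy => ?_⟩
        rw [hdot, hui, mul_zero, add_zero]
        exact hvF.2 y hy
      have h1 := hw _ hmem v hv.mem
      rw [hdot] at h1
      have h2 : t i * e w i ≤ t i * 0 := by linarith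
      exact le_antisymm (le_of_mul_le_mul_left h2 (ht i)) hw0
    · intro hw x hx y hy
      have h1 : w ⬝ᵥ v ≤ w ⬝ᵥ y := (hcone w).2 (fun i => (hw i).1) v rfl y hy
      refine le_trans ?_ h1
      -- M dominates all ratios of coordinates, so M•u - w is normal at v; as u is constant on its
      -- face, w is at most its value at v there. Terms with zero denominator are 0.
      set M : ℝ := ∑ i, e w i / e u i with hM
      have hmem : M • u - w ∈ normalCone P {v} := by
        rw [hcone]
        intro i
        rw [map_sub, map_smul, Pi.sub_apply, Pi.smul_apply, smul_eq_mul, sub_nonneg]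
        by_cases hi : 0 < e u i
        · rw [← div_le_iff₀ hi]
          exact Finset.single_le_sum (f := fun i => e w i / e u i)
            (fun j _ => div_nonneg (hw j).1 (hu0 j)) (Finset.mem_univ i)
        · have hui : e u i = 0 := le_antisymm (not_lt.1 hi) (hu0 i)
          rw [(hw i).2 (by rw [Finset.mem_filter_univ]; exact hi), hui, mul_zero]
      have h2 := hmem v rfl x hx.1
      rw [sub_dotProduct, sub_dotProduct, smul_dotProduct, smul_dotProduct,
        le_antisymm (hvF.2 x hx.1) (hx.2 v hv.mem)] at h2
      linarith
  refine ⟨e, ?_⟩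
  ext σ
  constructor
  · rintro ⟨⟨F, hF, rfl⟩, hle⟩
    have hvF : v ∈ F := (normalCone_le_iff hF hv).1 hle rfl
    obtain ⟨u, hu, hFu⟩ := hF.exists_mem_normalCone
    have hu' : u ∈ normalCone P {v} := hle hu
    refine ⟨Finset.univ.filter fun i => 0 < e u i, ?_⟩
    rw [← hface u hu', ← hFu]
  · rintro ⟨A, rfl⟩
    set u := e.symm (fun i => if i ∈ A then 1 else 0) with hu
    have heu : ∀ i, e u i = if i ∈ A then 1 else 0 := fun i => by
      rw [hu, LinearEquiv.apply_symm_apply]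
    have huv : u ∈ normalCone P {v} := by
      rw [hcone]
      intro i
      rw [heu]
      split_ifs <;> norm_num
    have hA : (Finset.univ.filter fun i => 0 < e u i) = A := by
      ext i
      rw [Finset.mem_filter_univ, heu]
      split_ifs with hi <;> simp [hi]
    have hvF : v ∈ minFace P u := ⟨hv.mem, huv v rfl⟩
    have h1 := hface u huv
    rw [hA] at h1
    rw [← h1]
    exact ⟨⟨_, isFace_minFace ⟨v, hvF⟩, rfl⟩, normalCone_anti (Set.singleton_subset_iff.2 hvF)⟩

/-! ### Counting cones in a star subdivision. -/

/-- A fan with a maximal cone `τ`, given in suitable coordinates by the nonnegative orthant, and a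
vector `x` in its interior. -/
structure SimplicialAt {n : ℕ} (fan : Set (PointedCone ℝ (Fin n → ℝ)))
    (τ : PointedCone ℝ (Fin n → ℝ)) (x : Fin n → ℝ)
    (e : (Fin n → ℝ) ≃ₗ[ℝ] (Fin n → ℝ)) : Prop where
  finite : fan.Finite
  maximal : Maximal (fun σ => σ ∈ fan) τ
  mem : x ∈ τ
  eq_of_mem : ∀ σ ∈ fan, x ∈ σ → σ = τ
  faces : {σ | σ ∈ fan ∧ σ ≤ τ} = Set.range (orthantFace e)

namespace SimplicialAt

variable {n : ℕ} {fan : Set (PointedCone ℝ (Fin n → ℝ))} {τ : PointedCone ℝ (Fin n → ℝ)}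
  {x : Fin n → ℝ} {e : (Fin n → ℝ) ≃ₗ[ℝ] (Fin n → ℝ)}

theorem mem_le_iff (h : SimplicialAt fan τ x e) {σ : PointedCone ℝ (Fin n → ℝ)} :
    σ ∈ fan ∧ σ ≤ τ ↔ ∃ A, orthantFace e A = σ := by
  have : σ ∈ {σ | σ ∈ fan ∧ σ ≤ τ} ↔ σ ∈ Set.range (orthantFace e) := by rw [h.faces]
  exact this

theorem orthantFace_mem (h : SimplicialAt fan τ x e) (A : Finset (Fin n)) :
    orthantFace e A ∈ fan := (h.mem_le_iff.2 ⟨A, rfl⟩).1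

theorem orthantFace_le (h : SimplicialAt fan τ x e) (A : Finset (Fin n)) :
    orthantFace e A ≤ τ := (h.mem_le_iff.2 ⟨A, rfl⟩).2

theorem eq_orthantFace_univ (h : SimplicialAt fan τ x e) : orthantFace e Finset.univ = τ := by
  obtain ⟨A, rfl⟩ := h.mem_le_iff.1 ⟨h.maximal.1, le_rfl⟩
  rw [Finset.univ_subset_iff.1 (orthantFace_le_iff.1 (h.orthantFace_le Finset.univ))]

theorem orthantFace_eq_iff (h : SimplicialAt fan τ x e) {A : Finset (Fin n)} :
    orthantFace e A = τ ↔ A = Finset.univ := by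
  rw [← h.eq_orthantFace_univ, (orthantFace_injective e).eq_iff]

theorem coneDim_eq (h : SimplicialAt fan τ x e) : coneDim τ = n := by
  rw [← h.eq_orthantFace_univ, coneDim_orthantFace, Finset.card_univ, Fintype.card_fin]

/-- A vanishing coordinate would place x in a coordinate facet, a cone of the fan other than τ. -/
theorem apply_pos (h : SimplicialAt fan τ x e) (i : Fin n) : 0 < e x i := by
  have hx := h.mem
  rw [← h.eq_orthantFace_univ] at hx
  refine lt_of_le_of_ne (hx i).1 fun h0 => ?_
  have hmem : x ∈ orthantFace e (Finset.univ.erase i) := fun j => ⟨(hx j).1, fun hj => by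
    have : j = i := by simpa using hj
    rw [this, ← h0]⟩
  have := h.orthantFace_eq_iff.1 (h.eq_of_mem _ (h.orthantFace_mem _) hmem)
  simp at this

/-- A vector of the face A vanishes in some coordinate where x is positive, so writing it as a•x + w
forces a = 0. -/
theorem orthantFace_le_hull_iff (h : SimplicialAt fan τ x e) {A B : Finset (Fin n)}
    (hA : A ≠ Finset.univ) :
    orthantFace e A ≤ PointedCone.hull ℝ {x} ⊔ orthantFace e B ↔ A ⊆ B := by
  constructor
  · intro hle
    rw [← orthantFace_le_iff (e := e)]
    intro y hy
    obtain ⟨a, ha, w, hw, rfl⟩ := mem_hull_singleton_sup.1 (hle hy)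
    obtain ⟨i, hi⟩ : ∃ i, i ∉ A := by
      by_contra! hall
      exact hA (Finset.eq_univ_of_forall hall)
    have h0 := (hy i).2 hi
    rw [map_add, map_smul, Pi.add_apply, Pi.smul_apply, smul_eq_mul] at h0
    have h1 := mul_nonneg ha (h.apply_pos i).le
    have h2 : a * e x i = 0 := by linarith [(hw i).1]
    have h3 : a = 0 := (mul_eq_zero.1 h2).resolve_right (h.apply_pos i).ne'
    rw [h3, zero_smul, zero_add]
    exact hw
  · intro hAB
    exact (orthantFace_le_iff.2 hAB).trans le_sup_right

theorem hull_le_hull_iff (h : SimplicialAt fan τ x e) {A B : Finset (Fin n)}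
    (hA : A ≠ Finset.univ) :
    PointedCone.hull ℝ {x} ⊔ orthantFace e A ≤ PointedCone.hull ℝ {x} ⊔ orthantFace e B ↔
      A ⊆ B := by
  constructor
  · exact fun hle => (h.orthantFace_le_hull_iff hA).1 (le_sup_right.trans hle)
  · exact fun hAB => sup_le_sup_left (orthantFace_le_iff.2 hAB) _

theorem mem_hull (φ : PointedCone ℝ (Fin n → ℝ)) :
    x ∈ PointedCone.hull ℝ {x} ⊔ φ :=
  mem_hull_singleton_sup.2 ⟨1, zero_le_one, 0, φ.zero_mem, by simp⟩

theorem hull_le (h : SimplicialAt fan τ x e) (A : Finset (Fin n)) :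
    PointedCone.hull ℝ {x} ⊔ orthantFace e A ≤ τ :=
  sup_le (Submodule.span_le.2 (Set.singleton_subset_iff.2 h.mem)) (h.orthantFace_le A)

theorem coneDim_hull (h : SimplicialAt fan τ x e) {A : Finset (Fin n)} (hA : A ≠ Finset.univ) :
    coneDim (PointedCone.hull ℝ {x} ⊔ orthantFace e A) = A.card + 1 := by
  obtain ⟨i, hi⟩ : ∃ i, i ∉ A := by
    by_contra! hall
    exact hA (Finset.eq_univ_of_forall hall)
  rw [coneDim_hull_singleton_sup, coneDim_orthantFace]
  exact fun hmem => (h.apply_pos i).ne' (apply_eq_zero_of_mem_span_orthantFace hmem hi)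

theorem mem_starSubdivision_iff (h : SimplicialAt fan τ x e) {σ : PointedCone ℝ (Fin n → ℝ)} :
    σ ∈ starSubdivision fan τ x ↔ (σ ∈ fan ∧ σ ≠ τ) ∨
      ∃ A ≠ Finset.univ, σ = PointedCone.hull ℝ {x} ⊔ orthantFace e A := by
  rw [_root_.mem_starSubdivision_iff h.maximal]
  refine or_congr_right ⟨?_, ?_⟩
  · rintro ⟨φ, hφ, hle, hne, rfl⟩
    obtain ⟨A, rfl⟩ := h.mem_le_iff.1 ⟨hφ, hle⟩
    exact ⟨A, fun hA => hne (h.orthantFace_eq_iff.2 hA), rfl⟩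
  · rintro ⟨A, hA, rfl⟩
    exact ⟨_, h.orthantFace_mem A, h.orthantFace_le A,
      fun heq => hA (h.orthantFace_eq_iff.1 heq), rfl⟩

/-- The number of cones of each dimension in a star subdivision. -/
theorem ncard_starSubdivision (h : SimplicialAt fan τ x e) {j : ℕ} (hj : j < n) :
    {σ | σ ∈ starSubdivision fan τ x ∧ coneDim σ = j + 1}.ncard + (if j + 1 = n then 1 else 0) =
      {σ | σ ∈ fan ∧ coneDim σ = j + 1}.ncard + n.choose j := by
  have hcard : ∀ A : Finset (Fin n), A.card = j → A ≠ Finset.univ := by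
    rintro A hA rfl
    rw [Finset.card_univ, Fintype.card_fin] at hA
    omega
  -- The new cones of dimension j+1 come from the subsets of size j. They are disjoint from the old
  -- ones because only new cones contain x once τ is gone.
  have hsplit : {σ | σ ∈ starSubdivision fan τ x ∧ coneDim σ = j + 1} =
      ({σ | σ ∈ fan ∧ coneDim σ = j + 1} \ {τ}) ∪
        (fun A => PointedCone.hull ℝ {x} ⊔ orthantFace e A) ''
          (Finset.powersetCard j (Finset.univ : Finset (Fin n)) : Set (Finset (Fin n))) := by
    ext σ
    simp only [Set.mem_union, Set.mem_sdiff, Set.mem_ofPred_eq, Set.mem_singleton_iff,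
      Set.mem_image, Finset.mem_coe, Finset.mem_powersetCard_univ, h.mem_starSubdivision_iff]
    constructor
    · rintro ⟨⟨hσ, hne⟩ | ⟨A, hA, rfl⟩, hd⟩
      · exact Or.inl ⟨⟨hσ, hd⟩, hne⟩
      · rw [h.coneDim_hull hA] at hd
        exact Or.inr ⟨A, by omega, rfl⟩
    · rintro (⟨⟨hσ, hd⟩, hne⟩ | ⟨A, hA, rfl⟩)
      · exact ⟨Or.inl ⟨hσ, hne⟩, hd⟩
      · exact ⟨Or.inr ⟨A, hcard A hA, rfl⟩, by rw [h.coneDim_hull (hcard A hA), hA]⟩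
  have hfin : {σ | σ ∈ fan ∧ coneDim σ = j + 1}.Finite := h.finite.subset fun σ hσ => hσ.1
  have hdisj : Disjoint ({σ | σ ∈ fan ∧ coneDim σ = j + 1} \ {τ})
      ((fun A => PointedCone.hull ℝ {x} ⊔ orthantFace e A) ''
        (Finset.powersetCard j (Finset.univ : Finset (Fin n)) : Set (Finset (Fin n)))) := by
    rw [Set.disjoint_left]
    rintro _ ⟨hσ, hne⟩ ⟨A, _, rfl⟩
    exact hne (h.eq_of_mem _ hσ.1 (mem_hull _))
  have hinj : Set.InjOn (fun A => PointedCone.hull ℝ {x} ⊔ orthantFace e A)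
      (Finset.powersetCard j (Finset.univ : Finset (Fin n)) : Set (Finset (Fin n))) := by
    intro A hA B hB heq
    rw [Finset.mem_coe, Finset.mem_powersetCard_univ] at hA hB
    have heq' : PointedCone.hull ℝ {x} ⊔ orthantFace e A =
        PointedCone.hull ℝ {x} ⊔ orthantFace e B := heq
    exact Finset.Subset.antisymm ((h.hull_le_hull_iff (hcard A hA)).1 heq'.le)
      ((h.hull_le_hull_iff (hcard B hB)).1 heq'.ge)
  rw [hsplit, Set.ncard_union_eq hdisj hfin.sdiff ((Finset.finite_toSet _).image _),
    hinj.ncard_image, Set.ncard_coe_finset, Finset.card_powersetCard,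
    Finset.card_univ, Fintype.card_fin]
  split_ifs with hjn
  · have hmem : τ ∈ {σ | σ ∈ fan ∧ coneDim σ = j + 1} :=
      ⟨h.maximal.1, by rw [h.coneDim_eq, hjn]⟩
    have := Set.ncard_sdiff_singleton_add_one hmem hfin
    omega
  · have hmem : τ ∉ {σ | σ ∈ fan ∧ coneDim σ = j + 1} := fun hmem => hjn (by
      have := hmem.2
      rw [h.coneDim_eq] at this
      exact this.symm)
    rw [Set.sdiff_singleton_eq_self hmem]
    omega

/-- If all `n`-dimensional cones of a fan have `n` facets, so do those of a star subdivision. -/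
theorem ncard_facets (h : SimplicialAt fan τ x e) (hn : 2 ≤ n)
    (hs : ∀ σ ∈ fan, coneDim σ = n → {ρ | ρ ∈ fan ∧ ρ ≤ σ ∧ coneDim ρ + 1 = n}.ncard = n)
    {σ : PointedCone ℝ (Fin n → ℝ)} (hσ : σ ∈ starSubdivision fan τ x) (hd : coneDim σ = n) :
    {ρ | ρ ∈ starSubdivision fan τ x ∧ ρ ≤ σ ∧ coneDim ρ + 1 = n}.ncard = n := by
  rcases h.mem_starSubdivision_iff.1 hσ with ⟨hσ, hne⟩ | ⟨B, hB, rfl⟩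
  -- A surviving cone does not contain x, so no new cone lies in it; and τ has full dimension, so it
  -- was not one of its facets.
  · refine Eq.trans (congrArg Set.ncard ?_) (hs σ hσ hd)
    ext ρ
    constructor
    · rintro ⟨hρ, hle, hdρ⟩
      rcases h.mem_starSubdivision_iff.1 hρ with ⟨hρ, _⟩ | ⟨A, _, rfl⟩
      · exact ⟨hρ, hle, hdρ⟩
      · exact absurd (h.eq_of_mem σ hσ (hle (mem_hull _))) hne
    · rintro ⟨hρ, hle, hdρ⟩
      refine ⟨h.mem_starSubdivision_iff.2 (Or.inl ⟨hρ, ?_⟩), hle, hdρ⟩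
      rintro rfl
      rw [h.coneDim_eq] at hdρ
      omega
  · rw [h.coneDim_hull hB] at hd
    have hcard : ∀ A ⊆ B, A ≠ Finset.univ := fun A hAB hA =>
      hB (Finset.univ_subset_iff.1 (hA ▸ hAB))
    -- Here B has n-1 elements: one facet is the base, and the other n-1 pass through x and arise by
    -- omitting one element of B.
    have hset : {ρ | ρ ∈ starSubdivision fan τ x ∧
        ρ ≤ PointedCone.hull ℝ {x} ⊔ orthantFace e B ∧ coneDim ρ + 1 = n} =
        insert (orthantFace e B) ((fun A => PointedCone.hull ℝ {x} ⊔ orthantFace e A) ''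
          (Finset.powersetCard (n - 2) B : Set (Finset (Fin n)))) := by
      ext ρ
      simp only [Set.mem_insert_iff, Set.mem_image, Finset.mem_coe, Finset.mem_powersetCard]
      constructor
      · rintro ⟨hρ, hle, hdρ⟩
        rcases h.mem_starSubdivision_iff.1 hρ with ⟨hρ, hne⟩ | ⟨A, hA, rfl⟩
        · left
          obtain ⟨A, rfl⟩ := h.mem_le_iff.1 ⟨hρ, hle.trans (h.hull_le B)⟩
          have hA : A ≠ Finset.univ := fun hA => hne (h.orthantFace_eq_iff.2 hA)
          rw [coneDim_orthantFace] at hdρ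
          rw [Finset.eq_of_subset_of_card_le ((h.orthantFace_le_hull_iff hA).1 hle) (by omega)]
        · right
          rw [h.coneDim_hull hA] at hdρ
          exact ⟨A, ⟨(h.hull_le_hull_iff hA).1 hle, by omega⟩, rfl⟩
      · rintro (rfl | ⟨A, ⟨hAB, hA⟩, rfl⟩)
        · refine ⟨h.mem_starSubdivision_iff.2 (Or.inl ⟨h.orthantFace_mem B,
            fun heq => hB (h.orthantFace_eq_iff.1 heq)⟩), le_sup_right, ?_⟩
          rw [coneDim_orthantFace, hd]
        · refine ⟨h.mem_starSubdivision_iff.2 (Or.inr ⟨A, hcard A hAB, rfl⟩),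
            (h.hull_le_hull_iff (hcard A hAB)).2 hAB, ?_⟩
          rw [h.coneDim_hull (hcard A hAB), hA]
          omega
    have hnot : orthantFace e B ∉ (fun A => PointedCone.hull ℝ {x} ⊔ orthantFace e A) ''
        (Finset.powersetCard (n - 2) B : Set (Finset (Fin n))) := by
      rintro ⟨A, _, heq⟩
      have heq' : PointedCone.hull ℝ {x} ⊔ orthantFace e A = orthantFace e B := heq
      have hx : x ∈ orthantFace e B := heq' ▸ mem_hull _
      exact hB (h.orthantFace_eq_iff.1 (h.eq_of_mem _ (h.orthantFace_mem B) hx))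
    have hinj : Set.InjOn (fun A => PointedCone.hull ℝ {x} ⊔ orthantFace e A)
        (Finset.powersetCard (n - 2) B : Set (Finset (Fin n))) := by
      intro A hA A' hA' heq
      rw [Finset.mem_coe, Finset.mem_powersetCard] at hA hA'
      have heq' : PointedCone.hull ℝ {x} ⊔ orthantFace e A =
          PointedCone.hull ℝ {x} ⊔ orthantFace e A' := heq
      exact Finset.Subset.antisymm ((h.hull_le_hull_iff (hcard A hA.1)).1 heq'.le)
        ((h.hull_le_hull_iff (hcard A' hA'.1)).1 heq'.ge)
    rw [hset, Set.ncard_insert_of_notMem hnot ((Finset.finite_toSet _).image _),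
      hinj.ncard_image, Set.ncard_coe_finset, Finset.card_powersetCard]
    obtain ⟨m, rfl⟩ := Nat.exists_eq_add_of_le hn
    have hBm : B.card = m + 1 := by omega
    rw [hBm, Nat.add_sub_cancel_left, Nat.choose_succ_self_right]
    omega

end SimplicialAt

/-! ### Reading face numbers and simplicity off the fan. -/

theorem IsPolytope.fVector_succ {n : ℕ} {P : Set (Fin n → ℝ)} (h : IsPolytope P) (k : ℕ) :
    fVector P (k + 1) = {σ | σ ∈ normalFan P ∧ coneDim σ = k + 1}.ncard := by
  have himg : {σ | σ ∈ normalFan P ∧ coneDim σ = k + 1} =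
      normalCone P '' {F | IsFace P F ∧ faceDim F + (k + 1) = n} := by
    ext σ
    constructor
    · rintro ⟨⟨F, hF, rfl⟩, hd⟩
      have := h.coneDim_normalCone hF
      exact ⟨F, ⟨hF, by omega⟩, rfl⟩
    · rintro ⟨F, ⟨hF, hd⟩, rfl⟩
      have := h.coneDim_normalCone hF
      exact ⟨⟨F, hF, rfl⟩, by omega⟩
  rw [himg, Set.InjOn.ncard_image fun F hF G hG heq => normalCone_injOn hF.1 hG.1 heq]
  rfl

theorem IsPolytope.ncard_edges {n : ℕ} {P : Set (Fin n → ℝ)} (h : IsPolytope P)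
    {v : Fin n → ℝ} (hv : IsVertex P v) :
    {E | IsEdge P E ∧ v ∈ E}.ncard =
      {ρ | ρ ∈ normalFan P ∧ ρ ≤ normalCone P {v} ∧ coneDim ρ + 1 = n}.ncard := by
  have himg : {ρ | ρ ∈ normalFan P ∧ ρ ≤ normalCone P {v} ∧ coneDim ρ + 1 = n} =
      normalCone P '' {E | IsEdge P E ∧ v ∈ E} := by
    ext σ
    constructor
    · rintro ⟨⟨F, hF, rfl⟩, hle, hd⟩
      have := h.coneDim_normalCone hF
      exact ⟨F, ⟨⟨hF, by omega⟩, (normalCone_le_iff hF hv).1 hle rfl⟩, rfl⟩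
    · rintro ⟨F, ⟨⟨hF, hd⟩, hvF⟩, rfl⟩
      have := h.coneDim_normalCone hF
      exact ⟨⟨F, hF, rfl⟩, normalCone_anti (Set.singleton_subset_iff.2 hvF), by omega⟩
  rw [himg, Set.InjOn.ncard_image fun F hF G hG heq => normalCone_injOn hF.1.1 hG.1.1 heq]

/-- A polytope is simple exactly if all `n`-dimensional cones of its normal fan have `n` facets. -/
theorem IsPolytope.isSimplePolytope_iff {n : ℕ} {P : Set (Fin n → ℝ)} (h : IsPolytope P) :
    IsSimplePolytope P ↔ ∀ σ ∈ normalFan P, coneDim σ = n →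
      {ρ | ρ ∈ normalFan P ∧ ρ ≤ σ ∧ coneDim ρ + 1 = n}.ncard = n := by
  constructor
  · rintro hs _ ⟨F, hF, rfl⟩ hd
    obtain ⟨v, hvF, hv⟩ := h.exists_vertex_mem hF
    have h1 := h.coneDim_normalCone hF
    have hFv : {v} = F := hv.eq_of_subset_of_faceDim_eq hF (Set.singleton_subset_iff.2 hvF)
      (by rw [faceDim_singleton]; omega)
    rw [← hFv, ← h.ncard_edges hv, hs v hv]
  · intro hs v hv
    rw [h.ncard_edges hv]
    refine hs _ ⟨{v}, hv, rfl⟩ ?_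
    have h1 := h.coneDim_normalCone hv
    rw [faceDim_singleton] at h1
    omega

/-! ### From face numbers to the `h`- and `g`-vectors. -/

/-- After multiplication by t - 1 both sides equal t^n - 1, by the binomial expansion of (1 +
(t-1))^n without its last term. -/
theorem sum_choose_mul_X_sub_one_pow (n : ℕ) :
    ∑ j ∈ Finset.range n, Polynomial.C (n.choose j : ℤ) * (Polynomial.X - 1) ^ (n - 1 - j) =
      ∑ i ∈ Finset.range n, (Polynomial.X : Polynomial ℤ) ^ i := by
  have hne : (Polynomial.X - 1 : Polynomial ℤ) ≠ 0 := by
    have := Polynomial.X_sub_C_ne_zero (1 : ℤ)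
    rwa [Polynomial.C_1] at this
  apply mul_left_cancel₀ hne
  rw [mul_geom_sum, Finset.mul_sum]
  have hbin := add_pow (1 : Polynomial ℤ) (Polynomial.X - 1) n
  rw [add_sub_cancel, Finset.sum_range_succ] at hbin
  rw [hbin]
  simp only [one_pow, one_mul, Nat.sub_self, pow_zero, Nat.choose_self, Nat.cast_one,
    add_sub_cancel_right]
  refine Finset.sum_congr rfl fun j hj => ?_
  have hj' := Finset.mem_range.1 hj
  have : n - j = (n - 1 - j) + 1 := by omega
  have hC : Polynomial.C (n.choose j : ℤ) = ((n.choose j : ℕ) : Polynomial ℤ) := by simp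
  rw [this, pow_succ, hC]
  ring

/-- The effect of a vertex truncation on the `h`-vector. -/
theorem hVector_eq_of_fVector {n : ℕ} {P Q : Set (Fin n → ℝ)} (hn : 1 ≤ n)
    (hf : ∀ j < n, fVector Q (j + 1) + (if j + 1 = n then 1 else 0) =
      fVector P (j + 1) + n.choose j) {k : ℕ} (hk : k ≤ n) :
    hVector Q k = hVector P k + if 1 ≤ k ∧ k < n then 1 else 0 := by
  have hpoly : hPolynomial Q + 1 =
      hPolynomial P + ∑ i ∈ Finset.range n, (Polynomial.X : Polynomial ℤ) ^ i := by
    rw [← sum_choose_mul_X_sub_one_pow, hPolynomial, hPolynomial,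
      Finset.sum_range_succ' _ n, Finset.sum_range_succ' _ n]
    have h0 : fVector Q 0 = fVector P 0 := rfl
    rw [h0]
    -- The lost maximal cone belongs to j = n-1, where the power of t - 1 is 0, so it accounts for
    -- the constant 1.
    have hone : (1 : Polynomial ℤ) = ∑ j ∈ Finset.range n,
        Polynomial.C (((if j + 1 = n then 1 else 0 : ℕ)) : ℤ) *
          (Polynomial.X - 1) ^ (n - (j + 1)) := by
      rw [Finset.sum_eq_single (n - 1)]
      · have : n - 1 + 1 = n := by omega
        simp [this]
      · intro j hj hjn
        have : j + 1 ≠ n := by omega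
        simp [this]
      · intro hmem
        rw [Finset.mem_range] at hmem
        omega
    have hsum : (∑ j ∈ Finset.range n, Polynomial.C (fVector Q (j + 1) : ℤ) *
        (Polynomial.X - 1) ^ (n - (j + 1))) + 1 =
        (∑ j ∈ Finset.range n, Polynomial.C (fVector P (j + 1) : ℤ) *
          (Polynomial.X - 1) ^ (n - (j + 1))) +
        ∑ j ∈ Finset.range n, Polynomial.C (n.choose j : ℤ) *
          (Polynomial.X - 1) ^ (n - 1 - j) := by
      conv_lhs => enter [2]; rw [hone]
      rw [← Finset.sum_add_distrib, ← Finset.sum_add_distrib]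
      refine Finset.sum_congr rfl fun j hj => ?_
      have hj' : n - 1 - j = n - (j + 1) := by omega
      rw [hj', ← add_mul, ← add_mul, ← Polynomial.C_add, ← Polynomial.C_add,
        ← Nat.cast_add, ← Nat.cast_add, hf j (Finset.mem_range.1 hj)]
    rw [add_right_comm, hsum, add_right_comm]
  -- The geometric sum reaches t^(n-k) only for k ≥ 1, and for k = n the constant 1 on the left
  -- cancels it.
  have hcoeff := congrArg (fun p : Polynomial ℤ => p.coeff (n - k)) hpoly
  simp only [Polynomial.coeff_add, Polynomial.coeff_one, Polynomial.finsetSum_coeff,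
    Polynomial.coeff_X_pow, Finset.sum_ite_eq, Finset.mem_range] at hcoeff
  rw [hVector, hVector]
  split_ifs at hcoeff ⊢ <;> omega

/-- For 2 ≤ k ≤ n/2 both k and k-1 lie strictly between 0 and n, so the two increments cancel; for k
= 1 only h_1 grows. -/
theorem gVector_eq_of_fVector {n : ℕ} {P Q : Set (Fin n → ℝ)} (hn : 2 ≤ n)
    (hf : ∀ j < n, fVector Q (j + 1) + (if j + 1 = n then 1 else 0) =
      fVector P (j + 1) + n.choose j) :
    gVector Q 0 = 1 ∧ gVector Q 1 = gVector P 1 + 1 ∧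
      ∀ k, 2 ≤ k → k ≤ n / 2 → gVector Q k = gVector P k := by
  refine ⟨rfl, ?_, fun k hk2 hkn => ?_⟩
  · change hVector Q 1 - hVector Q 0 = hVector P 1 - hVector P 0 + 1
    rw [hVector_eq_of_fVector (by omega) hf (by omega : 1 ≤ n),
      hVector_eq_of_fVector (by omega) hf (by omega : 0 ≤ n), if_pos (by omega), if_neg (by omega)]
    ring
  · obtain ⟨m, rfl⟩ : ∃ m, k = m + 1 := ⟨k - 1, by omega⟩
    change hVector Q (m + 1) - hVector Q m = hVector P (m + 1) - hVector P m
    rw [hVector_eq_of_fVector (by omega) hf (by omega : m + 1 ≤ n),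
      hVector_eq_of_fVector (by omega) hf (by omega : m ≤ n), if_pos (by omega), if_pos (by omega)]
    ring

/-! ### Assembling the result. -/

theorem IsSmoothPolytope.isFullPolytope {n : ℕ} {P : Set (Fin n → ℝ)} (h : IsSmoothPolytope P) :
    IsFullPolytope P := by
  classical
  obtain ⟨⟨⟨S, hS⟩, hspan⟩, -⟩ := h
  refine ⟨⟨S.image fun z i => (z i : ℝ), ?_⟩, hspan⟩
  rw [Finset.coe_image]
  exact hS

/-- A polytope whose normal fan is a star subdivision, at the normal cone of a vertex, of the
normal fan of a smooth polytope is simple, and its `g`-vector differs in the entry `g₁` only. -/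
theorem IsSmoothPolytope.of_isStarSubdivision {n : ℕ} (hn : 2 ≤ n) {P Q : Set (Fin n → ℝ)}
    (hP : IsSmoothPolytope P) {v : Fin n → ℝ} (hv : IsVertex P v) (hQ : IsPolytope Q)
    (hQP : IsStarSubdivision (normalFan P) (normalCone P {v}) (normalFan Q)) :
    IsSimplePolytope Q ∧ gVector Q 0 = 1 ∧ gVector Q 1 = gVector P 1 + 1 ∧
      ∀ k, 2 ≤ k → k ≤ n / 2 → gVector Q k = gVector P k := by
  have h : IsPolytope P := hP.isFullPolytope.1
  obtain ⟨x, hx, hfan⟩ := hQP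
  obtain ⟨e, he⟩ := hP.exists_orthantFace h hv
  rw [h.mem_intrinsicInterior_normalCone_iff hv] at hx
  have hS : SimplicialAt (normalFan P) (normalCone P {v}) x e := by
    refine ⟨?_, maximal_normalCone_vertex hv, ?_, ?_, he⟩
    · refine (h.finite_faces.image (normalCone P)).subset ?_
      rintro _ ⟨F, hF, rfl⟩
      exact ⟨F, hF, rfl⟩
    · rw [← hx]
      exact mem_normalCone_minFace
    -- A face whose normal cone contains x consists of minimizers of x, and v is the only one.
    · rintro _ ⟨F, hF, rfl⟩ hxF
      have hsub : F ⊆ {v} := by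
        rw [← hx]
        exact fun y hy => ⟨hF.subset hy, hxF y hy⟩
      rw [hF.2.subset_singleton_iff.1 hsub]
  refine ⟨hQ.isSimplePolytope_iff.2 ?_, gVector_eq_of_fVector hn fun j hj => ?_⟩
  · rw [hfan]
    exact fun σ hσ hd => hS.ncard_facets hn (h.isSimplePolytope_iff.1 hP.2.1) hσ hd
  · rw [hQ.fVector_succ, h.fVector_succ, hfan]
    exact hS.ncard_starSubdivision hj

theorem proposition2 (n : ℕ) (hn : 3 ≤ n) (P : Set (Fin n → ℝ)) (hP : IsSmoothPolytope P) :
    -- truncating a vertex by a hyperplane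
    (∀ v : Fin n → ℝ, IsVertex P v →
      Maximal (fun σ => σ ∈ normalFan P) (normalCone P {v}) ∧
      (∀ x ∈ intrinsicInterior ℝ (normalCone P {v} : Set (Fin n → ℝ)),
        ∃ Q : Set (Fin n → ℝ), IsVertexTruncation P v Q ∧
          normalFan Q = starSubdivision (normalFan P) (normalCone P {v}) x) ∧
      (∀ Q : Set (Fin n → ℝ), IsVertexTruncation P v Q →
        IsFullPolytope Q ∧ IsSimplePolytope Q ∧
        IsStarSubdivision (normalFan P) (normalCone P {v}) (normalFan Q) ∧
        gVector Q 0 = 1 ∧ gVector Q 1 = gVector P 1 + 1 ∧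
        ∀ k, 2 ≤ k → k ≤ n / 2 → gVector Q k = gVector P k)) ∧
    -- any polytope whose normal fan is a star subdivision at a maximal cone
    (∀ τ : PointedCone ℝ (Fin n → ℝ), Maximal (fun σ => σ ∈ normalFan P) τ →
      ∀ Q : Set (Fin n → ℝ), IsFullPolytope Q →
        IsStarSubdivision (normalFan P) τ (normalFan Q) →
        IsSimplePolytope Q ∧
        gVector Q 0 = 1 ∧ gVector Q 1 = gVector P 1 + 1 ∧
        ∀ k, 2 ≤ k → k ≤ n / 2 → gVector Q k = gVector P k) := by

  have hfull := hP.isFullPolytope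
  have h : IsPolytope P := hfull.1
  have : NeZero n := ⟨by omega⟩
  refine ⟨fun v hv => ⟨maximal_normalCone_vertex hv, fun x hx => ?_, ?_⟩, ?_⟩
  · rw [h.mem_intrinsicInterior_normalCone_iff hv] at hx
    obtain ⟨c, hc⟩ := h.exists_cutsOff hv hx
    exact ⟨truncation P x c, ⟨x, c, hc.lt, hc.lt_of_ne, rfl⟩, hc.normalFan_truncation h⟩
  · rintro Q ⟨u, c, hlt, hne, rfl⟩
    have hc : CutsOff P v u c := ⟨hv, hlt, hne⟩
    have hstar : IsStarSubdivision (normalFan P) (normalCone P {v})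
        (normalFan (truncation P u c)) :=
      ⟨u, (h.mem_intrinsicInterior_normalCone_iff hv).2 (hc.minFace_eq h),
        hc.normalFan_truncation h⟩
    have hQ := hc.isFullPolytope_truncation hfull
    obtain ⟨h1, h2⟩ := hP.of_isStarSubdivision (by omega) hv hQ.1 hstar
    exact ⟨hQ, h1, hstar, h2⟩
  · intro τ hτ Q hQ hstar
    obtain ⟨v, hv, rfl⟩ := h.exists_vertex_of_maximal hτ
    exact hP.of_isStarSubdivision (by omega) hv hQ.1 hstar
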